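/- Notation. Let $k\in\mathbb N$, $k\ge 1$. Let $\mu$ be the uniform probability measure on $[-1,1]^k$, let $L_n$ be the $n$th Legendre polynomial normalized in $L^2([-1,1];\frac{dx}{2})$, and let $L_\nu(y)=\prod_{j=1}^k L_{\nu_j}(y_j)$ for $\nu\in\mathbb N_0^k$. For $\rho>1$ let $\mathcal E_\rho=\{\frac{z+z^{-1}}{2} : z\in\mathbb C,\ 1\le |z|\le\rho\}$ be the Bernstein ellipse, and for $\xi\in(1,\infty)^k$ let $\mathcal E_\xi=\mathcal E_{\xi_1}\times\cdots\times\mathcal E_{\xi_k}$ and $\xi_{\min}=\min_j\xi_j$. Let $B_s=\{z\in\mathbb C:|z|<s\}$. By $f\in C^1(\mathcal E_\xi;B_r)$ we mean that $f:\mathcal E_\xi\to B_r$ is continuous, and complex differentiable in the interior of $\mathcal E_\xi$. Put $$\|u\|_{W^{m,\infty}([-1,1]^k)}=\max_{|\alpha|\le m}\|\partial^\alpha u\|_{L^\infty([-1,1]^k)},\qquad \gamma(\xi,\nu)=\xi_k^{-\max\{1,\nu_k\}}\prod_{j=1}^{k-1}\xi_j^{-\nu_j},$$ $$\Lambda_{k,\varepsilon}=\{\nu\in\mathbb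 N_0^k:\gamma(\xi,\nu)\ge\varepsilon\},\qquad \beta=\Big(k!\prod_{j=1}^k\log\xi_j\Big)^{1/k}.$$ Proposition. Let $k\ge 1$, $m\in\mathbb N_0$ and $\tau\in(0,1)$. There is a constant $C>0$, depending only on $k$, $m$, $\tau$ and $\xi_{\min}$, such that the following holds for all $\xi\in(1,\infty)^k$ with the given value of $\xi_{\min}$, all $r>0$ and all $f\in C^1(\mathcal E_\xi;B_r)$ with $f(\mathcal E_{\xi_1}\times\cdots\times\mathcal E_{\xi_{k-1}}\times[-1,1])\subseteq B_{r/\xi_k}$. Let $l_\nu=\int_{[-1,1]^k}f(y)L_\nu(y)\,\mu(dy)$ for $\nu\in\mathbb N_0^k$, and let $$M=\min\{r,\ \xi_k\|f\|_{L^\infty(\mathcal E_\xi)}\}.$$ Then for every $\varepsilon\in(0,\xi_k^{-1})$ the set $\Lambda_{k,\varepsilon}$ is finite, $f-\sum_{\nu\in\Lambda_{k,\varepsilon}}l_\nu L_\nu$ is $m$ times continuously differentiable on $(-1,1)^k$, and $$\Big\|f-\sum_{\nu\in\Lambda_{k,\varepsilon}}l_\nu L_\nu\Big\|_{W^{m,\infty}([-1,1]^k)}\le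 C\,M\,\varepsilon^\tau\le C\,M\exp\!\big(-\tau\beta|\Lambda_{k,\varepsilon}|^{1/k}\big)\prod_{j=1}^k\xi_j .$$ In particular, the error is at most $C_1\varepsilon^\tau\le C_1\exp(-\tau\beta|\Lambda_{k,\varepsilon}|^{1/k})\prod_{j=1}^k\xi_j$ with $C_1=Cr$ depending only on $k,m,\tau,\xi_{\min},r$. It is also at most $C_2\varepsilon^\tau\|f\|_{L^\infty(\mathcal E_\xi)}\le C_2\exp(-\tau\beta|\Lambda_{k,\varepsilon}|^{1/k})\|f\|_{L^\infty(\mathcal E_\xi)}\prod_{j=1}^k\xi_j$ with $C_2=C\xi_k$ depending only on $k,m,\tau,\xi_{\min},\xi_k$. -/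

import Mathlib

open MeasureTheory Set Polynomial
open scoped ENNReal Nat ContDiff

noncomputable section

namespace LegendreApprox

/-- The (filled, closed) Bernstein ellipse
`{(z + z⁻¹) / 2 : z ∈ ℂ, 1 ≤ |z| ≤ ρ}`. -/
def bernsteinEllipse (ρ : ℝ) : Set ℂ :=
  (fun z : ℂ => (z + z⁻¹) / 2) '' {z : ℂ | 1 ≤ ‖z‖ ∧ ‖z‖ ≤ ρ}

/-- The Bernstein polyellipse, the product of the ellipses with parameters `ξ j`. -/
def polyellipse {n : ℕ} (ξ : Fin n → ℝ) : Set (Fin n → ℂ) :=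
  {z | ∀ j, z j ∈ bernsteinEllipse (ξ j)}

/-- The product of the ellipses in all variables but the last one with the real interval `[-1,1]`
in the last variable. -/
def polyellipseRealLast {d : ℕ} (ξ : Fin (d + 1) → ℝ) : Set (Fin (d + 1) → ℂ) :=
  {z | (∀ j : Fin d, z j.castSucc ∈ bernsteinEllipse (ξ j.castSucc)) ∧
    ∃ t : ℝ, t ∈ Icc (-1 : ℝ) 1 ∧ z (Fin.last d) = (t : ℂ)}

/-- `f ∈ C¹(O; ℂ)` in the complex sense, for a set `O ⊆ ℂⁿ` that need not be open: `f` is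
continuous on `O` and complex differentiable on the interior of `O` (that is, on every open
subset of `O`). -/
def HolomorphicC1On {n : ℕ} (f : (Fin n → ℂ) → ℂ) (O : Set (Fin n → ℂ)) : Prop :=
  ContinuousOn f O ∧ DifferentiableOn ℂ f (interior O)

/-- The supremum norm of `f` on the set `O`. -/
def supNormOn {n : ℕ} (f : (Fin n → ℂ) → ℂ) (O : Set (Fin n → ℂ)) : ℝ :=
  ⨆ z : O, ‖f z‖

/-- The uniform probability measure on `[-1,1]`, i.e. half the Lebesgue measure. -/
def mu1 : Measure ℝ := (2 : ℝ≥0∞)⁻¹ • (volume : Measure ℝ).restrict (Icc (-1) 1)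

/-- The uniform probability measure on `[-1,1]ⁿ`. -/
def mu (n : ℕ) : Measure (Fin n → ℝ) := Measure.pi fun _ => mu1

/-- The `n`-th Legendre polynomial, normalized in `L²([-1,1]; mu1)`: `√(2n+1)` times the
classical Legendre polynomial, which is given by Rodrigues' formula. -/
def legendre (n : ℕ) : ℝ[X] :=
  C (Real.sqrt (2 * n + 1) / (2 ^ n * (n ! : ℝ))) * derivative^[n] ((X ^ 2 - 1) ^ n)

/-- The tensorized Legendre polynomial `L_ν(y) = ∏ j, L_{ν j}(y j)`. -/
def legendreTensor {n : ℕ} (ν : Fin n → ℕ) (y : Fin n → ℝ) : ℝ :=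
  ∏ j, (legendre (ν j)).eval (y j)

/-- The point of `ℂⁿ` given by a point of `ℝⁿ`. -/
def toComplex {n : ℕ} (y : Fin n → ℝ) : Fin n → ℂ := fun j => (y j : ℂ)

/-- The Legendre coefficient `∫_{[-1,1]ⁿ} f L_ν dμ`. -/
def legendreCoeff {n : ℕ} (f : (Fin n → ℂ) → ℂ) (ν : Fin n → ℕ) : ℂ :=
  ∫ y, f (toComplex y) * (legendreTensor ν y : ℂ) ∂(mu n)

/-- `γ(ξ,ν) = ξ_k ^ (-max {1, ν_k}) * ∏_{j<k} ξ_j ^ (-ν_j)`, where `k = d + 1`. -/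
def gamma {d : ℕ} (ξ : Fin (d + 1) → ℝ) (ν : Fin (d + 1) → ℕ) : ℝ :=
  (ξ (Fin.last d) ^ max 1 (ν (Fin.last d)))⁻¹ *
    ∏ j : Fin d, (ξ j.castSucc ^ ν j.castSucc)⁻¹

/-- The index set `Λ_{k,ε} = {ν : γ(ξ,ν) ≥ ε}`. -/
def indexSet {d : ℕ} (ξ : Fin (d + 1) → ℝ) (ε : ℝ) : Set (Fin (d + 1) → ℕ) :=
  {ν | ε ≤ gamma ξ ν}

/-- The difference of `f` and its Legendre expansion truncated to `Λ`, on `ℝⁿ`. -/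
def truncationError {n : ℕ} (f : (Fin n → ℂ) → ℂ) (Λ : Set (Fin n → ℕ)) (y : Fin n → ℝ) : ℂ :=
  f (toComplex y) - ∑ᶠ (ν : Fin n → ℕ) (_ : ν ∈ Λ), legendreCoeff f ν * (legendreTensor ν y : ℂ)

/-- The open cube `(-1,1)ⁿ`, the interior of `[-1,1]ⁿ`. -/
def openCube (n : ℕ) : Set (Fin n → ℝ) := Set.univ.pi fun _ => Ioo (-1) 1

/-- The partial derivative `∂u/∂x_j`. -/
def partialDeriv {n : ℕ} (j : Fin n) (u : (Fin n → ℝ) → ℂ) : (Fin n → ℝ) → ℂ :=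
  fun x => lineDeriv ℝ u x (Pi.single j 1)

/-- The mixed partial derivative `∂^|α| u / (∂x_1^{α_1} ⋯ ∂x_n^{α_n})`. -/
def multiDeriv {n : ℕ} (α : Fin n → ℕ) (u : (Fin n → ℝ) → ℂ) : (Fin n → ℝ) → ℂ :=
  (List.finRange n).foldr (fun j v => (partialDeriv j)^[α j] v) u

/-- The norm `max_{|α| ≤ m} ‖∂^α u‖_{L^∞}` of `W^{m,∞}([-1,1]ⁿ)`, for functions `u` that are `m`
times continuously differentiable on the open cube (the boundary is a null set). -/
def sobolevNorm {n : ℕ} (m : ℕ) (u : (Fin n → ℝ) → ℂ) : ℝ≥0∞ :=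
  ⨆ (α : Fin n → ℕ) (_ : ∑ j, α j ≤ m), eLpNorm (multiDeriv α u) ∞ (volume.restrict (openCube n))

/-- `β = (k! ∏ log ξ_j)^{1/k}`. -/
def beta {k : ℕ} (ξ : Fin k → ℝ) : ℝ :=
  ((k ! : ℝ) * ∏ j, Real.log (ξ j)) ^ (1 / (k : ℝ))

end LegendreApprox

end

/-! The Legendre coefficients are never estimated directly. With J(z) = (z + z⁻¹)/2, the function f
∘ J is holomorphic on the product of the annuli ξ_j⁻¹ < |z_j| < ξ_j, and its Fourier coefficients
c_n, n ∈ ℤ^k, on the unit torus are those of a Chebyshev expansion f = Σ c_n ∏ T_{n_j}. Moving the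
j-th circle towards radius ξ_j^{±1} according to the sign of n_j, and leaving it at 1 if n_j = 0,
gives |c_n| ≤ M γ(ξ,|n|) (`norm_chebyshevCoeff_le`). If n_k = 0, the last variable stays in [-1,1],
where f is bounded by M/ξ_k; this is the max{1, ν_k} in γ.

Since T_n has degree |n|, the product ∏ T_{n_j} is a combination of the L_ν with ν ≤ |n|, with
coefficients at most 1 in modulus. The set Λ is closed downwards because γ decreases, so truncation
to Λ reproduces every product with |n| ∈ Λ (`remainderJet_eq_zero`). The error is therefore a sum
over |n| ∉ Λ, where γ < ε and so γ = γ^τ γ^{1-τ} ≤ ε^τ ∏ ξ_min^{-(1-τ)|n_j|}. Derivatives of T_n and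
of its truncated Legendre expansion grow polynomially in |n| (`norm_remainderJet_le`), so the
geometric factor makes the differentiated series summable, with a constant depending only on k, m, τ
and ξ_min.

For the bound in terms of |Λ|, taking logarithms puts Λ inside the lattice points of a simplex,
which are counted by a discrete form of the volume formula (`ncard_latticeSimplex_le`). -/

namespace LegendreApprox

/-! ### Orthonormality of the Legendre polynomials and expansion in them. -/

section Polynomials

theorem integral_mu1 {E : Type*} [NormedAddCommGroup E] [NormedSpace ℝ E] (g : ℝ → E) :
    ∫ x, g x ∂mu1 = (2⁻¹ : ℝ) • ∫ x in (-1 : ℝ)..1, g x := by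
  rw [mu1, integral_smul_measure, intervalIntegral.integral_of_le (by norm_num),
    integral_Icc_eq_integral_Ioc]
  simp

instance isProbabilityMeasure_mu1 : IsProbabilityMeasure mu1 := by
  constructor
  rw [mu1, Measure.smul_apply, Measure.restrict_apply_univ, Real.volume_Icc, smul_eq_mul,
    show (1 - (-1) : ℝ) = 2 by norm_num, ENNReal.ofReal_ofNat]
  exact ENNReal.inv_mul_cancel (by norm_num) (by norm_num)

theorem ae_mu1_mem_Icc : ∀ᵐ x ∂mu1, x ∈ Icc (-1 : ℝ) 1 :=
  Measure.ae_smul_measure (ae_restrict_mem measurableSet_Icc) _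

theorem _root_.Continuous.integrable_mu1 {E : Type*} [NormedAddCommGroup E] {g : ℝ → E}
    (hg : Continuous g) : Integrable g mu1 :=
  (hg.continuousOn.integrableOn_compact isCompact_Icc).smul_measure (by simp)

theorem integral_mul_derivative (p q : ℝ[X]) (h1 : p.eval 1 = 0) (h2 : p.eval (-1) = 0) :
    ∫ x in (-1 : ℝ)..1, (derivative p * q).eval x
      = -∫ x in (-1 : ℝ)..1, (p * derivative q).eval x := by
  have := intervalIntegral.integral_mul_deriv_eq_deriv_mul (a := -1) (b := 1)
    (u := fun x => q.eval x) (v := fun x => p.eval x)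
    (fun x _ => q.hasDerivAt x) (fun x _ => p.hasDerivAt x)
    ((derivative q).continuous.intervalIntegrable _ _)
    ((derivative p).continuous.intervalIntegrable _ _)
  simp only [h1, h2, mul_zero, sub_zero, zero_sub] at this
  simpa [eval_mul, mul_comm] using this

/-- Fewer than n derivatives leave a factor X² - 1. This kills the boundary terms when Rodrigues'
formula is integrated by parts. -/
theorem eval_iterate_derivative_sq_sub_one {n i : ℕ} (hi : i < n) {x : ℝ} (hx : x ^ 2 = 1) :
    (derivative^[i] ((X ^ 2 - 1 : ℝ[X]) ^ n)).eval x = 0 := by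
  obtain ⟨q, hq⟩ := pow_sub_dvd_iterate_derivative_pow (X ^ 2 - 1 : ℝ[X]) n i
  rw [hq, eval_mul, eval_pow]
  simp [hx, Nat.sub_ne_zero_of_lt hi]

theorem integral_iterate_derivative_sq_sub_one_mul (n : ℕ) (q : ℝ[X]) (i : ℕ) (hi : i ≤ n) :
    ∫ x in (-1 : ℝ)..1, (derivative^[i] ((X ^ 2 - 1) ^ n) * q).eval x
      = (-1) ^ i * ∫ x in (-1 : ℝ)..1, ((X ^ 2 - 1) ^ n * derivative^[i] q).eval x := by
  induction i generalizing q with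
  | zero => simp
  | succ i ih =>
    rw [Function.iterate_succ_apply', integral_mul_derivative _ _
      (eval_iterate_derivative_sq_sub_one hi (by norm_num))
      (eval_iterate_derivative_sq_sub_one hi (by norm_num)), ih _ (by omega),
      ← Function.iterate_succ_apply]
    ring

theorem integral_one_sub_sq_pow (n : ℕ) :
    ((2 * n + 1)! : ℝ) * ∫ x in (-1 : ℝ)..1, (1 - x ^ 2) ^ n = 2 * 4 ^ n * (n ! : ℝ) ^ 2 := by
  induction n with
  | zero => norm_num
  | succ n ih =>
    have key : (2 * (n : ℝ) + 3) * ∫ x in (-1 : ℝ)..1, (1 - x ^ 2) ^ (n + 1)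
        = (2 * (n : ℝ) + 2) * ∫ x in (-1 : ℝ)..1, (1 - x ^ 2) ^ n := by
      -- The primitive x(1 - x²)^(n+1) vanishes at ±1, which yields the recurrence.
      have h := intervalIntegral.integral_eq_sub_of_hasDerivAt (a := -1) (b := 1)
        (f := fun x : ℝ => x * (1 - x ^ 2) ^ (n + 1))
        (f' := fun x => (2 * n + 3) * (1 - x ^ 2) ^ (n + 1) - (2 * n + 2) * (1 - x ^ 2) ^ n)
        (fun x _ => by
          have := (hasDerivAt_id x).mul ((((hasDerivAt_id x).pow 2).const_sub 1).pow (n + 1))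
          refine this.congr_deriv ?_
          simp
          ring)
        (Continuous.intervalIntegrable (by fun_prop) _ _)
      rw [intervalIntegral.integral_sub (Continuous.intervalIntegrable (by fun_prop) _ _)
        (Continuous.intervalIntegrable (by fun_prop) _ _),
        intervalIntegral.integral_const_mul, intervalIntegral.integral_const_mul] at h
      norm_num at h
      linarith
    have h3 : ((2 * (n + 1) + 1)! : ℝ) = (2 * n + 3) * (2 * n + 2) * ((2 * n + 1)! : ℝ) := by
      rw [show 2 * (n + 1) + 1 = (2 * n + 1 + 1) + 1 by ring, Nat.factorial_succ (2 * n + 1 + 1),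
        Nat.factorial_succ (2 * n + 1)]
      push_cast
      ring
    rw [h3, Nat.factorial_succ n]
    push_cast
    linear_combination (2 * n + 2) * ((2 * n + 1)! : ℝ) * key + (2 * n + 2) ^ 2 * ih

theorem natDegree_sq_sub_one_pow (n : ℕ) : ((X ^ 2 - 1 : ℝ[X]) ^ n).natDegree = n * 2 := by
  rw [natDegree_pow, show (X ^ 2 - 1 : ℝ[X]) = X ^ 2 - C 1 by simp, natDegree_X_pow_sub_C]

theorem coeff_sq_sub_one_pow (n : ℕ) : ((X ^ 2 - 1 : ℝ[X]) ^ n).coeff (2 * n) = 1 := by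
  have h : ((X ^ 2 - C 1 : ℝ[X]) ^ n).Monic := (monic_X_pow_sub_C 1 (by norm_num)).pow n
  have := h.coeff_natDegree
  rwa [map_one, natDegree_sq_sub_one_pow, mul_comm] at this

theorem degree_legendre (n : ℕ) : (legendre n).degree = n := by
  have h0 : Real.sqrt (2 * n + 1) / (2 ^ n * (n ! : ℝ)) ≠ 0 := by positivity
  rw [legendre, degree_C_mul h0]
  apply le_antisymm
  · refine natDegree_le_iff_degree_le.1 ((natDegree_iterate_derivative _ _).trans ?_)
    rw [natDegree_sq_sub_one_pow]
    omega
  · refine le_degree_of_ne_zero ?_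
    rw [coeff_iterate_derivative, ← two_mul, coeff_sq_sub_one_pow]
    simp only [nsmul_eq_mul, mul_one, ne_eq, Nat.cast_eq_zero, Nat.descFactorial_eq_zero_iff_lt]
    omega

theorem iterate_derivative_two_mul_sq_sub_one (n : ℕ) :
    derivative^[2 * n] ((X ^ 2 - 1 : ℝ[X]) ^ n) = C ((2 * n)! : ℝ) := by
  have h : (derivative^[2 * n] ((X ^ 2 - 1 : ℝ[X]) ^ n)).natDegree = 0 := by
    have := natDegree_iterate_derivative ((X ^ 2 - 1 : ℝ[X]) ^ n) (2 * n)
    rw [natDegree_sq_sub_one_pow] at this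
    omega
  rw [eq_C_of_natDegree_eq_zero h, coeff_iterate_derivative, zero_add, coeff_sq_sub_one_pow]
  simp [Nat.descFactorial_self]

theorem integral_legendre_mul_of_natDegree_lt {n : ℕ} {q : ℝ[X]} (hq : q.natDegree < n) :
    ∫ x, (legendre n).eval x * q.eval x ∂mu1 = 0 := by
  rw [integral_mu1]
  have h := integral_iterate_derivative_sq_sub_one_mul n q n le_rfl
  rw [iterate_derivative_eq_zero hq] at h
  simp only [mul_zero, eval_zero, intervalIntegral.integral_zero] at h
  simp only [legendre, eval_mul, eval_C, mul_assoc]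
  rw [intervalIntegral.integral_const_mul]
  simp only [eval_mul] at h
  simp [h]

theorem integral_legendre_mul_self (n : ℕ) :
    ∫ x, (legendre n).eval x * (legendre n).eval x ∂mu1 = 1 := by
  rw [integral_mu1]
  have h := integral_iterate_derivative_sq_sub_one_mul n
    (derivative^[n] ((X ^ 2 - 1 : ℝ[X]) ^ n)) n le_rfl
  rw [← Function.iterate_add_apply, ← two_mul, iterate_derivative_two_mul_sq_sub_one] at h
  have h2 := integral_one_sub_sq_pow n
  have h3 : (-1) ^ n * ∫ x in (-1 : ℝ)..1, ((X ^ 2 - 1) ^ n * C ((2 * n)! : ℝ)).eval x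
      = ((2 * n)! : ℝ) * ∫ x in (-1 : ℝ)..1, (1 - x ^ 2) ^ n := by
    rw [← intervalIntegral.integral_const_mul, ← intervalIntegral.integral_const_mul]
    congr 1
    ext x
    simp only [eval_mul, eval_pow, eval_sub, eval_X, eval_one, eval_C]
    rw [← mul_assoc, ← mul_pow]
    ring
  rw [h3] at h
  have h4 : ∀ x : ℝ, (legendre n).eval x * (legendre n).eval x
      = (2 * n + 1) / (2 ^ n * (n ! : ℝ)) ^ 2 *
        (derivative^[n] ((X ^ 2 - 1 : ℝ[X]) ^ n) * derivative^[n] ((X ^ 2 - 1 : ℝ[X]) ^ n)).eval x := by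
    intro x
    simp only [legendre, eval_mul, eval_C]
    have := Real.mul_self_sqrt (show (0 : ℝ) ≤ 2 * n + 1 by positivity)
    field_simp
    rw [Real.sq_sqrt (by positivity)]
  simp_rw [h4]
  rw [intervalIntegral.integral_const_mul, h, smul_eq_mul]
  rw [Nat.factorial_succ] at h2
  push_cast at h2
  rw [mul_pow, ← pow_mul, mul_comm n 2, pow_mul]
  norm_num
  field_simp
  linear_combination h2

/-- The Legendre polynomials as a polynomial sequence. -/
noncomputable def legendreSequence : Polynomial.Sequence ℝ where
  elems' := legendre
  degree_eq' := degree_legendre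

/-- Both sides are linear in q and agree on S 0, ..., S n, which span the polynomials of degree at
most n. It serves both the Legendre polynomials and the Chebyshev polynomials of the second kind. -/
theorem eq_sum_of_dual (S : Polynomial.Sequence ℝ) (F : ℕ → ℝ[X] →ₗ[ℝ] ℝ)
    (h : ∀ i j, F i (S j) = if i = j then 1 else 0) {n : ℕ} {q : ℝ[X]} (hq : q.natDegree ≤ n) :
    q = ∑ i ∈ Finset.range (n + 1), F i q • S i := by
  have hmem : q ∈ Submodule.span ℝ (S '' Set.Iic n) := by
    rw [S.span_degreeLE (fun i _ => isUnit_iff_ne_zero.2 (leadingCoeff_ne_zero.2 (S.ne_zero i))),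
      mem_degreeLE]
    exact natDegree_le_iff_degree_le.1 hq
  clear hq
  induction hmem using Submodule.span_induction with
  | mem x hx =>
    obtain ⟨j, hj, rfl⟩ := hx
    have : j < n + 1 := Nat.lt_succ_of_le hj
    simp [h, this]
  | zero => simp
  | add x y _ _ hx hy =>
    simp only [map_add, add_smul, Finset.sum_add_distrib]
    rw [← hx, ← hy]
  | smul a x _ hx =>
    simp only [map_smul, smul_assoc, ← Finset.smul_sum]
    rw [← hx]

/-- The functional `q ↦ ∫ q L_n dμ`. -/
noncomputable def legendreFunctional (n : ℕ) : ℝ[X] →ₗ[ℝ] ℝ where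
  toFun q := ∫ x, q.eval x * (legendre n).eval x ∂mu1
  map_add' p q := by
    simp only [eval_add, add_mul]
    exact integral_add (Continuous.integrable_mu1 (by fun_prop))
      (Continuous.integrable_mu1 (by fun_prop))
  map_smul' a q := by
    simp only [eval_smul, smul_eq_mul, mul_assoc, RingHom.id_apply]
    exact integral_const_mul _ _

theorem legendreFunctional_eq_zero {n : ℕ} {q : ℝ[X]} (hq : q.natDegree < n) :
    legendreFunctional n q = 0 := by
  change ∫ x, q.eval x * (legendre n).eval x ∂mu1 = 0
  simp_rw [mul_comm (q.eval _)]
  exact integral_legendre_mul_of_natDegree_lt hq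

theorem natDegree_legendre (n : ℕ) : (legendre n).natDegree = n :=
  natDegree_eq_of_degree_eq_some (degree_legendre n)

theorem legendreFunctional_legendre (i j : ℕ) :
    legendreFunctional i (legendre j) = if i = j then 1 else 0 := by
  rcases lt_trichotomy i j with h | rfl | h
  · rw [if_neg h.ne]
    exact integral_legendre_mul_of_natDegree_lt (by rwa [natDegree_legendre])
  · rw [if_pos rfl]
    exact integral_legendre_mul_self i
  · rw [if_neg h.ne', legendreFunctional_eq_zero (by rwa [natDegree_legendre])]

theorem eq_sum_legendre {n : ℕ} {q : ℝ[X]} (hq : q.natDegree ≤ n) :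
    q = ∑ i ∈ Finset.range (n + 1), legendreFunctional i q • legendre i :=
  eq_sum_of_dual legendreSequence legendreFunctional legendreFunctional_legendre hq

/-- Integrating |t| ≤ (1 + t²)/2 replaces Cauchy–Schwarz. -/
theorem integral_abs_legendre_le_one (n : ℕ) : ∫ x, |(legendre n).eval x| ∂mu1 ≤ 1 := by
  have h : ∫ x, |(legendre n).eval x| ∂mu1
      ≤ ∫ x, ((1 / 2 : ℝ) + 1 / 2 * ((legendre n).eval x * (legendre n).eval x)) ∂mu1 := by
    refine integral_mono (Continuous.integrable_mu1 (by fun_prop))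
      (Continuous.integrable_mu1 (by fun_prop)) fun x => ?_
    simp only
    nlinarith [sq_nonneg (|(legendre n).eval x| - 1), sq_abs ((legendre n).eval x)]
  rw [integral_add (Continuous.integrable_mu1 (by fun_prop))
    (Continuous.integrable_mu1 (by fun_prop)), integral_const_mul, integral_legendre_mul_self] at h
  simp at h
  linarith

theorem abs_legendreFunctional_le_one (n : ℕ) {q : ℝ[X]} (hq : ∀ x ∈ Icc (-1 : ℝ) 1, |q.eval x| ≤ 1) :
    |legendreFunctional n q| ≤ 1 := by
  refine (abs_integral_le_integral_abs).trans ((integral_mono_ae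
    (Continuous.integrable_mu1 (by fun_prop)) (Continuous.integrable_mu1 (by fun_prop)) ?_).trans
    (integral_abs_legendre_le_one n))
  filter_upwards [ae_mu1_mem_Icc] with x hx
  rw [abs_mul]
  exact mul_le_of_le_one_left (abs_nonneg _) (hq x hx)

end Polynomials

/-! ### Polynomial growth of derivatives of Chebyshev and Legendre polynomials. -/

section DerivativeBounds

open Polynomial.Chebyshev

/-- Derivatives of T_n are combinations of Chebyshev polynomials with natural number coefficients,
and each T_m attains its maximum modulus 1 at the point 1. -/
theorem abs_iterate_derivative_T_le_eval_one (n r : ℕ) {x : ℝ} (hx : x ∈ Icc (-1 : ℝ) 1) :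
    |(derivative^[r] (T ℝ n)).eval x| ≤ (derivative^[r] (T ℝ n)).eval 1 := by
  have h := T_iterate_derivative_mem_span_T (R := ℝ) n r
  generalize derivative^[r] (T ℝ n) = p at h ⊢
  induction h using Submodule.span_induction with
  | mem p hp =>
    obtain ⟨m, -, rfl⟩ := hp
    simpa using abs_eval_T_real_le_one m (abs_le.2 hx)
  | zero => simp
  | add p q _ _ hp hq =>
    rw [eval_add, eval_add]
    exact (abs_add_le _ _).trans (add_le_add hp hq)
  | smul a p _ hp =>
    rw [eval_smul, eval_smul, nsmul_eq_mul, nsmul_eq_mul, abs_mul, Nat.abs_cast]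
    exact mul_le_mul_of_nonneg_left hp (Nat.cast_nonneg a)

/-- At 1 each further derivative multiplies the value by (n² - r²)/(2r + 1), which is at most n². -/
theorem iterate_derivative_T_eval_one_le (n r : ℕ) :
    (derivative^[r] (T ℝ n)).eval 1 ≤ (n : ℝ) ^ (2 * r) := by
  induction r with
  | zero => simp
  | succ r ih =>
    have h := iterate_derivative_T_eval_one_recurrence (R := ℝ) n r
    have h0 : ∀ s, 0 ≤ (derivative^[s] (T ℝ n)).eval 1 := fun s =>
      (abs_nonneg _).trans (abs_iterate_derivative_T_le_eval_one n s (x := 1) (by simp))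
    push_cast at h
    have h1 : (derivative^[r + 1] (T ℝ n)).eval 1
        ≤ (n : ℝ) ^ 2 * (derivative^[r] (T ℝ n)).eval 1 := by
      nlinarith [mul_nonneg (Nat.cast_nonneg (α := ℝ) r) (h0 (r + 1)),
        mul_nonneg (sq_nonneg (r : ℝ)) (h0 r)]
    calc _ ≤ _ := h1
      _ ≤ (n : ℝ) ^ 2 * (n : ℝ) ^ (2 * r) := by gcongr
      _ = _ := by ring

/-- A crude form of Markov's inequality for the Chebyshev polynomials. -/
theorem abs_iterate_derivative_T_le (n r : ℕ) {x : ℝ} (hx : x ∈ Icc (-1 : ℝ) 1) :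
    |(derivative^[r] (T ℝ n)).eval x| ≤ (n : ℝ) ^ (2 * r) :=
  (abs_iterate_derivative_T_le_eval_one n r hx).trans (iterate_derivative_T_eval_one_le n r)

theorem abs_iterate_derivative_U_le (n r : ℕ) {x : ℝ} (hx : x ∈ Icc (-1 : ℝ) 1) :
    |(derivative^[r] (U ℝ n)).eval x| ≤ ((n : ℝ) + 1) ^ (2 * r + 2) := by
  have h := abs_iterate_derivative_T_le (n + 1) (r + 1) hx
  have h1 := T_derivative_eq_U (R := ℝ) ((n + 1 : ℕ) : ℤ)
  rw [show (((n + 1 : ℕ) : ℤ) : ℝ[X]) = C ((n : ℝ) + 1) by simp,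
    show ((n + 1 : ℕ) : ℤ) - 1 = n by push_cast; ring] at h1
  rw [Function.iterate_succ_apply, h1, iterate_derivative_C_mul, eval_mul, eval_C, abs_mul,
    abs_of_nonneg (by positivity)] at h
  push_cast at h
  refine le_trans ?_ (h.trans (le_of_eq (by ring)))
  exact le_mul_of_one_le_left (abs_nonneg _) (by simp)

theorem integral_sin_mul_sin (a b : ℕ) :
    ∫ θ in (0 : ℝ)..Real.pi, Real.sin ((a + 1) * θ) * Real.sin ((b + 1) * θ)
      = if a = b then Real.pi / 2 else 0 := by
  have hcos : ∀ c : ℤ, c ≠ 0 → ∫ θ in (0 : ℝ)..Real.pi, Real.cos (c * θ) = 0 := by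
    intro c hc
    rw [intervalIntegral.integral_comp_mul_left _ (by exact_mod_cast hc)]
    simp [integral_cos]
  have h : ∀ θ : ℝ, Real.sin ((a + 1) * θ) * Real.sin ((b + 1) * θ)
      = (1 / 2) * (Real.cos (((a : ℤ) - b : ℤ) * θ) - Real.cos (((a : ℤ) + b + 2 : ℤ) * θ)) := by
    intro θ
    have e1 : (((a : ℤ) - b : ℤ) : ℝ) * θ = (a + 1) * θ - (b + 1) * θ := by push_cast; ring
    have e2 : (((a : ℤ) + b + 2 : ℤ) : ℝ) * θ = (a + 1) * θ + (b + 1) * θ := by push_cast; ring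
    rw [e1, e2, Real.cos_sub, Real.cos_add]
    ring
  simp_rw [h]
  rw [intervalIntegral.integral_const_mul, intervalIntegral.integral_sub
    (Continuous.intervalIntegrable (by fun_prop) _ _)
    (Continuous.intervalIntegrable (by fun_prop) _ _), hcos (a + b + 2) (by omega)]
  split_ifs with hab
  · subst hab
    simp
    ring
  · rw [hcos _ (by omega)]
    simp

/-- The coefficient functional of the expansion in Chebyshev polynomials of the second kind. -/
noncomputable def chebyshevUFunctional (k : ℕ) : ℝ[X] →ₗ[ℝ] ℝ where
  toFun q := 2 / Real.pi *
    ∫ θ in (0 : ℝ)..Real.pi, q.eval (Real.cos θ) * Real.sin θ * Real.sin ((k + 1) * θ)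
  map_add' p q := by
    simp only [eval_add, add_mul]
    rw [intervalIntegral.integral_add (Continuous.intervalIntegrable (by fun_prop) _ _)
      (Continuous.intervalIntegrable (by fun_prop) _ _), mul_add]
  map_smul' a q := by
    simp only [eval_smul, smul_eq_mul, mul_assoc, RingHom.id_apply]
    rw [intervalIntegral.integral_const_mul]
    ring

/-- The Chebyshev polynomials of the second kind as a polynomial sequence. -/
noncomputable def chebyshevUSequence : Polynomial.Sequence ℝ where
  elems' n := U ℝ n
  degree_eq' := degree_U_natCast ℝ

theorem chebyshevUFunctional_U (i j : ℕ) :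
    chebyshevUFunctional i (U ℝ j) = if i = j then 1 else 0 := by
  change 2 / Real.pi * ∫ θ in (0 : ℝ)..Real.pi,
    (U ℝ j).eval (Real.cos θ) * Real.sin θ * Real.sin ((i + 1) * θ) = _
  simp_rw [U_real_cos]
  have := integral_sin_mul_sin j i
  push_cast at this ⊢
  rw [this]
  rcases eq_or_ne i j with rfl | h
  · simp [Real.pi_ne_zero]
  · simp [h, h.symm]

theorem integral_abs_eval_cos_mul_sin (q : ℝ[X]) :
    ∫ θ in (0 : ℝ)..Real.pi, |q.eval (Real.cos θ)| * Real.sin θ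
      = ∫ x in (-1 : ℝ)..1, |q.eval x| := by
  have h := intervalIntegral.integral_comp_mul_deriv (a := 0) (b := Real.pi)
    (f := Real.cos) (f' := fun θ => -Real.sin θ) (g := fun x => |q.eval x|)
    (fun x _ => Real.hasDerivAt_cos x) (by fun_prop) (by fun_prop)
  simp only [Function.comp_def, mul_neg, intervalIntegral.integral_neg, Real.cos_zero,
    Real.cos_pi] at h
  rw [intervalIntegral.integral_symm 1 (-1), ← h, neg_neg]

/-- Under x = cos θ the factor sin θ becomes dx, so the coefficient is controlled by the L¹ norm of
L_n alone. -/
theorem abs_chebyshevUFunctional_legendre_le (k n : ℕ) :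
    |chebyshevUFunctional k (legendre n)| ≤ 2 := by
  have h1 : |∫ θ in (0 : ℝ)..Real.pi, (legendre n).eval (Real.cos θ) * Real.sin θ *
      Real.sin ((k + 1) * θ)| ≤ 2 := by
    have h2 := integral_abs_legendre_le_one n
    rw [integral_mu1, ← integral_abs_eval_cos_mul_sin, smul_eq_mul] at h2
    have h3 : |∫ θ in (0 : ℝ)..Real.pi, (legendre n).eval (Real.cos θ) * Real.sin θ *
      Real.sin ((k + 1) * θ)| ≤
        ∫ θ in (0 : ℝ)..Real.pi, |(legendre n).eval (Real.cos θ)| * Real.sin θ := by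
      refine (intervalIntegral.abs_integral_le_integral_abs Real.pi_pos.le).trans
        (intervalIntegral.integral_mono_on Real.pi_pos.le
          (Continuous.intervalIntegrable (by fun_prop) _ _)
          (Continuous.intervalIntegrable (by fun_prop) _ _) fun θ hθ => ?_)
      rw [abs_mul, abs_mul, abs_of_nonneg (Real.sin_nonneg_of_mem_Icc hθ)]
      exact mul_le_of_le_one_right (mul_nonneg (abs_nonneg _) (Real.sin_nonneg_of_mem_Icc hθ))
        (Real.abs_sin_le_one _)
    linarith
  change |2 / Real.pi * _| ≤ 2
  rw [abs_mul, abs_of_nonneg (by positivity)]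
  have h2 : 2 / Real.pi ≤ 1 := by
    rw [div_le_one Real.pi_pos]
    exact Real.two_le_pi
  calc _ ≤ 1 * 2 := mul_le_mul h2 h1 (abs_nonneg _) zero_le_one
    _ = 2 := by norm_num

/-- L_n is a combination of U_0, ..., U_n with coefficients at most 2. The n + 1 terms account for
the power beyond the bound for the U_i. -/
theorem abs_iterate_derivative_legendre_le (n r : ℕ) {x : ℝ} (hx : x ∈ Icc (-1 : ℝ) 1) :
    |(derivative^[r] (legendre n)).eval x| ≤ 2 * ((n : ℝ) + 1) ^ (2 * r + 3) := by
  rw [eq_sum_of_dual chebyshevUSequence chebyshevUFunctional chebyshevUFunctional_U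
    (natDegree_legendre n).le, iterate_derivative_sum, eval_finsetSum]
  calc _ ≤ ∑ i ∈ Finset.range (n + 1), 2 * ((n : ℝ) + 1) ^ (2 * r + 2) := by
        refine (Finset.abs_sum_le_sum_abs _ _).trans (Finset.sum_le_sum fun i hi => ?_)
        rw [iterate_derivative_smul, eval_smul, smul_eq_mul, abs_mul]
        refine mul_le_mul (abs_chebyshevUFunctional_legendre_le i n)
          ((abs_iterate_derivative_U_le i r hx).trans ?_) (abs_nonneg _) zero_le_two
        have : (i : ℝ) ≤ n := by exact_mod_cast Nat.lt_succ_iff.1 (Finset.mem_range.1 hi)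
        gcongr
    _ = _ := by
        simp
        ring

end DerivativeBounds

/-! ### Families of mixed derivatives and termwise differentiation of series. -/

section Jets

variable {n : ℕ} {ι : Type*}

/-- The differential with the given partial derivatives. -/
noncomputable def differential {n : ℕ} (c : Fin n → ℂ) : (Fin n → ℝ) →L[ℝ] ℂ :=
  ∑ j, (ContinuousLinearMap.proj j : (Fin n → ℝ) →L[ℝ] ℝ).smulRight (c j)

theorem differential_apply (c : Fin n → ℂ) (v : Fin n → ℝ) :
    differential c v = ∑ j, v j • c j := by
  simp [differential]

theorem differential_single (c : Fin n → ℂ) (j : Fin n) :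
    differential c (Pi.single j 1) = c j := by
  rw [differential_apply, Finset.sum_eq_single j] <;> simp +contextual

theorem norm_differential_le (c : Fin n → ℂ) : ‖differential c‖ ≤ ∑ j, ‖c j‖ := by
  refine ContinuousLinearMap.opNorm_le_bound _ (Finset.sum_nonneg fun _ _ => norm_nonneg _)
    fun v => ?_
  rw [differential_apply, Finset.sum_mul]
  refine (norm_sum_le _ _).trans (Finset.sum_le_sum fun j _ => ?_)
  rw [norm_smul, mul_comm]
  exact mul_le_mul_of_nonneg_left (norm_le_pi_norm v j) (norm_nonneg _)

theorem isOpen_openCube (n : ℕ) : IsOpen (openCube n) :=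
  isOpen_set_pi Set.finite_univ fun _ _ => isOpen_Ioo

theorem isPreconnected_openCube (n : ℕ) : IsPreconnected (openCube n) :=
  (convex_pi fun _ _ => convex_Ioo _ _).isPreconnected

/-- A family of functions indexed by multi-indices, in which the partial derivative in the `j`-th
direction is given by the increment of the `j`-th index. -/
def IsJet (F : (Fin n → ℕ) → (Fin n → ℝ) → ℂ) (U : Set (Fin n → ℝ)) : Prop :=
  ∀ α, ∀ y ∈ U, HasFDerivAt (F α) (differential fun j => F (α + Pi.single j 1) y) y

theorem IsJet.contDiffOn {F : (Fin n → ℕ) → (Fin n → ℝ) → ℂ} {U : Set (Fin n → ℝ)}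
    (hF : IsJet F U) (hU : IsOpen U) (m : ℕ) (α : Fin n → ℕ) : ContDiffOn ℝ m (F α) U := by
  induction m generalizing α with
  | zero =>
    exact contDiffOn_zero.2 fun y hy => (hF α y hy).continuousAt.continuousWithinAt
  | succ m ih =>
    push_cast
    rw [contDiffOn_succ_iff_fderiv_of_isOpen hU]
    refine ⟨fun y hy => (hF α y hy).differentiableAt.differentiableWithinAt, by simp, ?_⟩
    have h : ContDiffOn ℝ m (fun y => differential fun j => F (α + Pi.single j 1) y) U := by
      simp only [differential]
      exact ContDiffOn.sum fun j _ => (ContinuousLinearMap.smulRightL ℝ (Fin n → ℝ) ℂ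
        (ContinuousLinearMap.proj j)).contDiff.comp_contDiffOn (ih _)
    exact h.congr fun y hy => (hF α y hy).fderiv

theorem IsJet.partialDeriv_eq {F : (Fin n → ℕ) → (Fin n → ℝ) → ℂ} {U : Set (Fin n → ℝ)}
    (hF : IsJet F U) (hU : IsOpen U) {u : (Fin n → ℝ) → ℂ} {α : Fin n → ℕ} (hu : EqOn u (F α) U)
    (j : Fin n) : EqOn (partialDeriv j u) (F (α + Pi.single j 1)) U := by
  intro y hy
  have h : u =ᶠ[nhds y] F α := hu.eventuallyEq_of_mem (hU.mem_nhds hy)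
  rw [partialDeriv, h.lineDeriv_eq,
    (hF α y hy).differentiableAt.lineDeriv_eq_fderiv, (hF α y hy).fderiv, differential_single]

theorem IsJet.iterate_partialDeriv_eq {F : (Fin n → ℕ) → (Fin n → ℝ) → ℂ} {U : Set (Fin n → ℝ)}
    (hF : IsJet F U) (hU : IsOpen U) {u : (Fin n → ℝ) → ℂ} {α : Fin n → ℕ} (hu : EqOn u (F α) U)
    (j : Fin n) (r : ℕ) : EqOn ((partialDeriv j)^[r] u) (F (α + Pi.single j r)) U := by
  induction r with
  | zero => simpa using hu
  | succ r ih =>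
    rw [Function.iterate_succ_apply']
    have := hF.partialDeriv_eq hU ih j
    rwa [add_assoc, ← Pi.single_add] at this

theorem IsJet.multiDeriv_eq {F : (Fin n → ℕ) → (Fin n → ℝ) → ℂ} {U : Set (Fin n → ℝ)}
    (hF : IsJet F U) (hU : IsOpen U) {u : (Fin n → ℝ) → ℂ} (hu : EqOn u (F 0) U)
    (α : Fin n → ℕ) : EqOn (multiDeriv α u) (F α) U := by
  have key : ∀ l : List (Fin n), EqOn (l.foldr (fun j v => (partialDeriv j)^[α j] v) u)
      (F (l.map fun j => Pi.single j (α j)).sum) U := by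
    intro l
    induction l with
    | nil => simpa using hu
    | cons j l ih =>
      have := hF.iterate_partialDeriv_eq hU ih j (α j)
      rw [add_comm] at this
      simpa using this
  have h := key (List.finRange n)
  rwa [← List.ofFn_eq_map, List.sum_ofFn, Finset.univ_sum_single] at h

theorem isJet_tsum {g : ι → (Fin n → ℕ) → (Fin n → ℝ) → ℂ}
    (hg : ∀ i, IsJet (g i) (openCube n))
    (hb : ∀ α, ∃ b : ι → ℝ, Summable b ∧ ∀ i, ∀ y ∈ openCube n, ‖g i α y‖ ≤ b i) :
    IsJet (fun α y => ∑' i, g i α y) (openCube n) := by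
  intro α y hy
  choose b hbs hb using hb
  have hs : ∀ α, ∀ y ∈ openCube n, Summable fun i => g i α y := fun α y hy =>
    Summable.of_norm_bounded (hbs α) fun i => hb α i y hy
  -- The differential of a term is dominated by the sum of the bounds for its partial derivatives,
  -- indexed by α + e_j.
  have h := hasFDerivAt_tsum_of_isPreconnected (𝕜 := ℝ)
    (u := fun i => ∑ j, b (α + Pi.single j 1) i) (f := fun i => g i α)
    (f' := fun i y => differential fun j => g i (α + Pi.single j 1) y)
    (summable_sum fun j _ => hbs _) (isOpen_openCube n) (isPreconnected_openCube n)
    (fun i y hy => hg i α y hy)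
    (fun i y hy => (norm_differential_le _).trans (Finset.sum_le_sum fun j _ => hb _ i y hy))
    hy (hs α y hy) hy
  refine h.congr_fderiv ?_
  ext v
  have hsum : HasSum (fun i => differential (fun j => g i (α + Pi.single j 1) y))
      (differential fun j => ∑' i, g i (α + Pi.single j 1) y) := by
    simp only [differential]
    exact hasSum_sum fun j _ => ((ContinuousLinearMap.smulRightL ℝ (Fin n → ℝ) ℂ
      (ContinuousLinearMap.proj j)).hasSum (hs _ y hy).hasSum)
  rw [hsum.tsum_eq]

theorem IsJet.const_mul {F : (Fin n → ℕ) → (Fin n → ℝ) → ℂ} {U : Set (Fin n → ℝ)}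
    (hF : IsJet F U) (c : ℂ) : IsJet (fun α y => c * F α y) U := by
  intro α y hy
  refine ((hF α y hy).const_mul c).congr_fderiv ?_
  ext v
  simp [differential_apply, Finset.mul_sum, mul_left_comm]

theorem IsJet.sub {F G : (Fin n → ℕ) → (Fin n → ℝ) → ℂ} {U : Set (Fin n → ℝ)}
    (hF : IsJet F U) (hG : IsJet G U) : IsJet (fun α y => F α y - G α y) U := by
  intro α y hy
  refine ((hF α y hy).sub (hG α y hy)).congr_fderiv ?_
  ext v
  simp [differential_apply, mul_sub]

theorem IsJet.sum {F : ι → (Fin n → ℕ) → (Fin n → ℝ) → ℂ} {U : Set (Fin n → ℝ)} (s : Finset ι)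
    (hF : ∀ i ∈ s, IsJet (F i) U) : IsJet (fun α y => ∑ i ∈ s, F i α y) U := by
  intro α y hy
  refine (HasFDerivAt.fun_sum fun i hi => hF i hi α y hy).congr_fderiv ?_
  ext v
  simp only [differential_apply, Finset.smul_sum, _root_.sum_apply]
  exact Finset.sum_comm

/-- The mixed derivatives of a product of polynomials in one variable each. -/
noncomputable def polyTensor (p : Fin n → ℝ[X]) (α : Fin n → ℕ) (y : Fin n → ℝ) : ℂ :=
  ((∏ j, (derivative^[α j] (p j)).eval (y j) : ℝ) : ℂ)

theorem isJet_polyTensor (p : Fin n → ℝ[X]) (U : Set (Fin n → ℝ)) : IsJet (polyTensor p) U := by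
  intro α y _
  have h1 : ∀ j ∈ (Finset.univ : Finset (Fin n)),
      HasFDerivAt (fun y : Fin n → ℝ => (derivative^[α j] (p j)).eval (y j))
        ((derivative^[α j + 1] (p j)).eval (y j) •
          (ContinuousLinearMap.proj j : (Fin n → ℝ) →L[ℝ] ℝ)) y := by
    intro j _
    have h := ((derivative^[α j] (p j)).hasDerivAt (y j)).comp_hasFDerivAt y
      (ContinuousLinearMap.proj j : (Fin n → ℝ) →L[ℝ] ℝ).hasFDerivAt
    rw [Function.iterate_succ_apply']
    exact h
  have h2 := Complex.ofRealCLM.hasFDerivAt.comp y (HasFDerivAt.finsetProd h1)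
  refine h2.congr_fderiv ?_
  ext v
  simp only [differential_apply, ContinuousLinearMap.comp_apply, _root_.sum_apply,
    _root_.smul_apply, map_sum]
  refine Finset.sum_congr rfl fun j _ => ?_
  have h3 : polyTensor p (α + Pi.single j 1) y
      = (((∏ i ∈ Finset.univ.erase j, (derivative^[α i] (p i)).eval (y i)) *
        (derivative^[α j + 1] (p j)).eval (y j) : ℝ) : ℂ) := by
    rw [polyTensor, ← Finset.prod_erase_mul _ _ (Finset.mem_univ j)]
    congr 2
    · refine Finset.prod_congr rfl fun i hi => ?_
      simp [Pi.single_eq_of_ne (Finset.ne_of_mem_erase hi)]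
    · simp
  rw [h3]
  simp only [ContinuousLinearMap.proj_apply, smul_eq_mul, Complex.ofRealCLM_apply,
    Complex.real_smul]
  push_cast
  ring

end Jets

/-! ### Lattice points in a simplex and the cardinality of Λ. -/

section Counting

/-- A lower Riemann sum for the integral of (k+1)(Y - t)^k over [0, Na]: each term is at most a
difference of powers, by a Bernoulli inequality, and the differences telescope. -/
theorem sum_range_pow_le (k : ℕ) {a : ℝ} (ha : 0 ≤ a) (N : ℕ) {Y : ℝ} (hY : N * a ≤ Y) :
    ∑ n ∈ Finset.range N, (k + 1) * a * (Y - (n + 1) * a) ^ k ≤ Y ^ (k + 1) - (Y - N * a) ^ (k + 1) := by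
  induction N with
  | zero => simp
  | succ N ih =>
    push_cast at hY ⊢
    rw [Finset.sum_range_succ]
    have h0 : 0 ≤ Y - (N + 1) * a := by linarith
    have h1 : (k + 1) * a * (Y - (N + 1) * a) ^ k ≤ (Y - N * a) ^ (k + 1) - (Y - (N + 1) * a) ^ (k + 1) := by
      have h := pow_add_mul_le_add_pow h0 (b := a) (by linarith) (k + 1)
      rw [show Y - N * a = Y - (N + 1) * a + a by ring]
      push_cast at h
      linarith
    linarith [ih (by linarith)]

/-- The lattice points of a simplex. -/
def latticeSimplex {k : ℕ} (a : Fin k → ℝ) (R : ℝ) : Set (Fin k → ℕ) :=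
  {ν | ∑ j, ν j * a j ≤ R}

theorem finite_latticeSimplex {k : ℕ} {a : Fin k → ℝ} (ha : ∀ j, 0 < a j) (R : ℝ) :
    (latticeSimplex a R).Finite := by
  refine (Set.finite_Iic fun j => ⌊R / a j⌋₊).subset fun ν hν j => Nat.le_floor ?_
  rw [le_div_iff₀ (ha j)]
  exact (Finset.single_le_sum (f := fun j => (ν j : ℝ) * a j)
    (fun i _ => mul_nonneg (Nat.cast_nonneg _) (ha i).le) (Finset.mem_univ j)).trans hν

/-- A discrete form of the volume formula, by slicing along the first coordinate. In the slice ν_0 =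
n, the level R - n a_0 enlarged by the remaining a_j is (R + Σ a_j) - (n+1) a_0, so the inductive
bounds form exactly the Riemann sum of `sum_range_pow_le`. -/
theorem ncard_latticeSimplex_le {k : ℕ} {a : Fin k → ℝ} (ha : ∀ j, 0 < a j) {R : ℝ} (hR : 0 ≤ R) :
    ((latticeSimplex a R).ncard : ℝ) * ((k ! : ℝ) * ∏ j, a j) ≤ (R + ∑ j, a j) ^ k := by
  induction k generalizing R with
  | zero =>
    have : (latticeSimplex a R).ncard ≤ 1 :=
      (Set.ncard_le_ncard (Set.subset_univ _)).trans (by simp)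
    simpa using this
  | succ k ih =>
    set N := ⌊R / a 0⌋₊ + 1 with hN
    have hN' : ∀ n ∈ Finset.range N, (n : ℝ) * a 0 ≤ R := fun n hn => by
      rw [← le_div_iff₀ (ha 0)]
      exact (Nat.le_floor_iff (div_nonneg hR (ha 0).le)).1 (Nat.lt_succ_iff.1 (Finset.mem_range.1 hn))
    have hsub : latticeSimplex a R ⊆ ⋃ n ∈ Finset.range N,
        Fin.cons (α := fun _ => ℕ) n '' latticeSimplex (fun j => a j.succ) (R - n * a 0) := by
      intro ν hν
      have hν' : (ν 0 : ℝ) * a 0 + ∑ j : Fin k, (ν j.succ : ℝ) * a j.succ ≤ R := by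
        rw [← Fin.sum_univ_succ fun j => (ν j : ℝ) * a j]
        exact hν
      have h0 : 0 ≤ ∑ j : Fin k, (ν j.succ : ℝ) * a j.succ :=
        Finset.sum_nonneg fun j _ => mul_nonneg (Nat.cast_nonneg _) (ha _).le
      simp only [Set.mem_iUnion]
      refine ⟨ν 0, Finset.mem_range.2 (Nat.lt_succ_iff.2 (Nat.le_floor ?_)), Fin.tail ν, ?_,
        Fin.cons_self_tail ν⟩
      · rw [le_div_iff₀ (ha 0)]
        linarith
      · change ∑ j : Fin k, (ν j.succ : ℝ) * a j.succ ≤ R - ν 0 * a 0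
        linarith
    have hcard : ((latticeSimplex a R).ncard : ℝ) ≤ ∑ n ∈ Finset.range N,
        ((latticeSimplex (fun j => a j.succ) (R - n * a 0)).ncard : ℝ) := by
      have hfin : (⋃ n ∈ Finset.range N, Fin.cons (α := fun _ => ℕ) n ''
          latticeSimplex (fun j => a j.succ) (R - n * a 0)).Finite :=
        (Finset.range N).finite_toSet.biUnion fun n _ =>
          (finite_latticeSimplex (fun j => ha j.succ) _).image _
      have h1 := Set.ncard_le_ncard hsub hfin
      have h2 := Finset.set_ncard_biUnion_le (Finset.range N) fun n : ℕ =>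
        Fin.cons (α := fun _ => ℕ) n '' latticeSimplex (fun j => a j.succ) (R - n * a 0)
      have h3 : ∑ n ∈ Finset.range N, (Fin.cons (α := fun _ => ℕ) n ''
          latticeSimplex (fun j => a j.succ) (R - n * a 0)).ncard
          ≤ ∑ n ∈ Finset.range N, (latticeSimplex (fun j => a j.succ) (R - n * a 0)).ncard :=
        Finset.sum_le_sum fun n _ =>
          Set.ncard_image_le (finite_latticeSimplex (fun j => ha j.succ) _)
      exact_mod_cast h1.trans (h2.trans h3)
    have hS : 0 ≤ ∑ j : Fin k, a j.succ := Finset.sum_nonneg fun j _ => (ha _).le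
    have ha0 := ha 0
    calc ((latticeSimplex a R).ncard : ℝ) * (((k + 1)! : ℝ) * ∏ j, a j)
        ≤ (∑ n ∈ Finset.range N, ((latticeSimplex (fun j => a j.succ) (R - n * a 0)).ncard : ℝ))
            * (((k + 1)! : ℝ) * ∏ j, a j) :=
          mul_le_mul_of_nonneg_right hcard
            (mul_nonneg (Nat.cast_nonneg _) (Finset.prod_nonneg fun j _ => (ha j).le))
      _ = ∑ n ∈ Finset.range N, (k + 1) * a 0 *
            (((latticeSimplex (fun j => a j.succ) (R - n * a 0)).ncard : ℝ) *
              ((k ! : ℝ) * ∏ j : Fin k, a j.succ)) := by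
          rw [Finset.sum_mul, Fin.prod_univ_succ, Nat.factorial_succ]
          push_cast
          exact Finset.sum_congr rfl fun n _ => by ring
      _ ≤ ∑ n ∈ Finset.range N, (k + 1) * a 0 *
            ((R + ∑ j, a j) - (n + 1) * a 0) ^ k := by
          refine Finset.sum_le_sum fun n hn => mul_le_mul_of_nonneg_left ?_ (by positivity)
          refine (ih (fun j => ha j.succ) (by linarith [hN' n hn])).trans (le_of_eq ?_)
          rw [Fin.sum_univ_succ]
          ring
      _ ≤ (R + ∑ j, a j) ^ (k + 1) - ((R + ∑ j, a j) - N * a 0) ^ (k + 1) := by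
          refine sum_range_pow_le k ha0.le N ?_
          -- The last slice satisfies (N - 1) a_0 ≤ R, hence N a_0 ≤ R + a_0.
          have := hN' (N - 1) (by simp [hN])
          rw [Fin.sum_univ_succ]
          rw [hN, Nat.add_sub_cancel] at this
          rw [hN]
          push_cast at this ⊢
          linarith
      _ ≤ (R + ∑ j, a j) ^ (k + 1) := by
          have := hN' (N - 1) (by simp [hN])
          have h2 : (0 : ℝ) ≤ (R + ∑ j, a j) - N * a 0 := by
            rw [Fin.sum_univ_succ]
            rw [hN, Nat.add_sub_cancel] at this
            rw [hN]
            push_cast at this ⊢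
            linarith
          linarith [pow_nonneg h2 (k + 1)]

theorem gamma_le_prod {d : ℕ} {ξ : Fin (d + 1) → ℝ} (hξ : ∀ j, 1 < ξ j) (ν : Fin (d + 1) → ℕ) :
    gamma ξ ν ≤ ∏ j, (ξ j ^ ν j)⁻¹ := by
  rw [gamma, Fin.prod_univ_castSucc, mul_comm]
  have h := (hξ (Fin.last d)).le
  refine mul_le_mul_of_nonneg_left ?_ (Finset.prod_nonneg fun j _ =>
    inv_nonneg.2 (pow_nonneg (zero_le_one.trans (hξ _).le) _))
  exact inv_anti₀ (pow_pos (zero_lt_one.trans_le h) _) (pow_le_pow_right₀ h (le_max_right _ _))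

theorem indexSet_subset_latticeSimplex {d : ℕ} {ξ : Fin (d + 1) → ℝ} (hξ : ∀ j, 1 < ξ j) {ε : ℝ}
    (hε : 0 < ε) : indexSet ξ ε ⊆ latticeSimplex (fun j => Real.log (ξ j)) (-Real.log ε) := by
  intro ν hν
  have h0 : ∀ j, 0 < ξ j := fun j => zero_lt_one.trans (hξ j)
  have h := Real.log_le_log hε ((show ε ≤ _ from hν).trans (gamma_le_prod hξ ν))
  rw [Real.log_prod fun j _ => inv_ne_zero (pow_ne_zero _ (h0 j).ne')] at h
  simp only [Real.log_inv, Real.log_pow, Finset.sum_neg_distrib] at h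
  change ∑ j, (ν j : ℝ) * Real.log (ξ j) ≤ _
  linarith

theorem finite_indexSet {d : ℕ} {ξ : Fin (d + 1) → ℝ} (hξ : ∀ j, 1 < ξ j) {ε : ℝ}
    (hε : 0 < ε) : (indexSet ξ ε).Finite :=
  (finite_latticeSimplex (fun j => Real.log_pos (hξ j)) _).subset
    (indexSet_subset_latticeSimplex hξ hε)

theorem rpow_le_exp_mul_prod {d : ℕ} {ξ : Fin (d + 1) → ℝ} (hξ : ∀ j, 1 < ξ j) {ε : ℝ}
    (hε : 0 < ε) (hε1 : ε ≤ 1) {τ : ℝ} (hτ : τ ∈ Ioo (0 : ℝ) 1) :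
    ε ^ τ ≤ Real.exp (-τ * beta ξ * ((indexSet ξ ε).ncard : ℝ) ^ (1 / ((d + 1 : ℕ) : ℝ))) *
      ∏ j, ξ j := by
  have ha : ∀ j, 0 < Real.log (ξ j) := fun j => Real.log_pos (hξ j)
  have h0 : ∀ j, 0 < ξ j := fun j => zero_lt_one.trans (hξ j)
  have hR : 0 ≤ -Real.log ε := by linarith [Real.log_nonpos hε.le hε1]
  have hS : 0 ≤ ∑ j, Real.log (ξ j) := Finset.sum_nonneg fun j _ => (ha j).le
  have hb : 0 ≤ ((d + 1)! : ℝ) * ∏ j, Real.log (ξ j) :=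
    mul_nonneg (Nat.cast_nonneg _) (Finset.prod_nonneg fun j _ => (ha j).le)
  have hcard : ((indexSet ξ ε).ncard : ℝ) ≤
      ((latticeSimplex (fun j => Real.log (ξ j)) (-Real.log ε)).ncard : ℝ) := by
    exact_mod_cast Set.ncard_le_ncard (indexSet_subset_latticeSimplex hξ hε)
      (finite_latticeSimplex ha _)
  have h1 : beta ξ * ((indexSet ξ ε).ncard : ℝ) ^ (1 / ((d + 1 : ℕ) : ℝ))
      ≤ -Real.log ε + ∑ j, Real.log (ξ j) := by
    rw [beta, ← Real.mul_rpow hb (Nat.cast_nonneg _), mul_comm]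
    calc _ ≤ ((-Real.log ε + ∑ j, Real.log (ξ j)) ^ (d + 1)) ^ (1 / ((d + 1 : ℕ) : ℝ)) :=
          Real.rpow_le_rpow (mul_nonneg (Nat.cast_nonneg _) hb)
            ((mul_le_mul_of_nonneg_right hcard hb).trans (ncard_latticeSimplex_le ha hR))
            (by positivity)
      _ = _ := by
          rw [one_div, Real.pow_rpow_inv_natCast (by positivity) (by omega)]
  have h2 : ∏ j, ξ j = Real.exp (∑ j, Real.log (ξ j)) := by
    rw [Real.exp_sum]
    exact Finset.prod_congr rfl fun j _ => (Real.exp_log (h0 j)).symm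
  rw [h2, ← Real.exp_add, Real.rpow_def_of_pos hε]
  refine Real.exp_le_exp.2 ?_
  -- The count is multiplied by τ, and τ Σ log ξ_j ≤ Σ log ξ_j as τ < 1.
  nlinarith [mul_le_mul_of_nonneg_left h1 hτ.1.le, mul_nonneg (sub_nonneg.2 hτ.2.le) hS]

end Counting

/-! ### The Joukowski map and the description of the ellipse by its foci. -/

section BernsteinEllipse

/-- The Joukowski map. -/
noncomputable def joukowski (z : ℂ) : ℂ := (z + z⁻¹) / 2

/-- J(z) ∓ 1 = (z ∓ 1)²/(2z), and the parallelogram law sums the squares. The ellipse thereby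
becomes a sublevel set of the sum of distances to ±1. -/
theorem norm_joukowski_sub_add {z : ℂ} (hz : z ≠ 0) :
    ‖joukowski z - 1‖ + ‖joukowski z + 1‖ = ‖z‖ + ‖z‖⁻¹ := by
  have h1 : joukowski z - 1 = (z - 1) ^ 2 / (2 * z) := by
    rw [joukowski]; field_simp; ring
  have h2 : joukowski z + 1 = (z + 1) ^ 2 / (2 * z) := by
    rw [joukowski]; field_simp; ring
  have h3 := parallelogram_law_with_norm ℝ z 1
  have h0 : ‖z‖ ≠ 0 := norm_ne_zero_iff.2 hz
  simp only [norm_one] at h3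
  rw [h1, h2, norm_div, norm_div, norm_pow, norm_pow, norm_mul, Complex.norm_ofNat]
  field_simp
  linear_combination h3

theorem joukowski_inv (z : ℂ) : joukowski z⁻¹ = joukowski z := by
  rw [joukowski, joukowski, inv_inv, add_comm]

theorem exists_joukowski_eq (w : ℂ) : ∃ z : ℂ, z ≠ 0 ∧ 1 ≤ ‖z‖ ∧ joukowski z = w := by
  -- The preimages of w are w ± √(w² - 1); they are mutually inverse, so one has modulus at least 1.
  obtain ⟨s, hs⟩ := IsAlgClosed.exists_pow_nat_eq (w ^ 2 - 1) (n := 2) (by norm_num)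
  have hne : w + s ≠ 0 := by
    intro h
    have : s = -w := by linear_combination h
    rw [this] at hs
    have : (0 : ℂ) = -1 := by linear_combination hs
    norm_num at this
  have hj : joukowski (w + s) = w := by
    rw [joukowski]
    field_simp
    linear_combination hs
  rcases le_total 1 ‖w + s‖ with h | h
  · exact ⟨w + s, hne, h, hj⟩
  · refine ⟨(w + s)⁻¹, inv_ne_zero hne, ?_, by rw [joukowski_inv, hj]⟩
    rw [norm_inv]
    exact one_le_inv_iff₀.2 ⟨norm_pos_iff.2 hne, h⟩

theorem add_inv_le_add_inv_iff {a b : ℝ} (ha : 1 ≤ a) (hb : 1 ≤ b) :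
    a + a⁻¹ ≤ b + b⁻¹ ↔ a ≤ b := by
  have e : b + b⁻¹ - (a + a⁻¹) = (b - a) * (1 - (a * b)⁻¹) := by
    field_simp
    ring
  have hab : 1 ≤ a * b := one_le_mul_of_one_le_of_one_le ha hb
  constructor
  · intro h
    by_contra! hlt
    have h1 : 0 < 1 - (a * b)⁻¹ := sub_pos.2 (inv_lt_one_of_one_lt₀ (by nlinarith))
    nlinarith
  · intro h
    have h1 : 0 ≤ 1 - (a * b)⁻¹ := sub_nonneg.2 (inv_le_one_of_one_le₀ hab)
    nlinarith

theorem mem_bernsteinEllipse_iff {ρ : ℝ} (hρ : 1 ≤ ρ) {w : ℂ} :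
    w ∈ bernsteinEllipse ρ ↔ ‖w - 1‖ + ‖w + 1‖ ≤ ρ + ρ⁻¹ := by
  constructor
  · rintro ⟨z, ⟨hz1, hz2⟩, rfl⟩
    have hz : z ≠ 0 := norm_pos_iff.1 (zero_lt_one.trans_le hz1)
    change ‖joukowski z - 1‖ + ‖joukowski z + 1‖ ≤ _
    rw [norm_joukowski_sub_add hz]
    exact (add_inv_le_add_inv_iff hz1 hρ).2 hz2
  · intro h
    obtain ⟨z, hz, hz1, rfl⟩ := exists_joukowski_eq w
    rw [norm_joukowski_sub_add hz, add_inv_le_add_inv_iff hz1 hρ] at h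
    exact ⟨z, ⟨hz1, h⟩, rfl⟩

theorem add_inv_lt_of_mem_Ioo {ρ s : ℝ} (hρ : 1 < ρ) (hs : s ∈ Ioo ρ⁻¹ ρ) :
    s + s⁻¹ < ρ + ρ⁻¹ := by
  have h0 : 0 < ρ := zero_lt_one.trans hρ
  have hs0 : 0 < s := (inv_pos.2 h0).trans hs.1
  have h1 : 1 < s * ρ := by
    have := mul_lt_mul_of_pos_right hs.1 h0
    rwa [inv_mul_cancel₀ h0.ne'] at this
  have e : ρ + ρ⁻¹ - (s + s⁻¹) = (ρ - s) * (1 - (s * ρ)⁻¹) := by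
    field_simp
    ring
  have := mul_pos (sub_pos.2 hs.2) (sub_pos.2 (inv_lt_one_of_one_lt₀ h1))
  linarith

theorem joukowski_mem_interior {ρ : ℝ} (hρ : 1 < ρ) {z : ℂ} (hz : ‖z‖ ∈ Ioo ρ⁻¹ ρ) :
    joukowski z ∈ interior (bernsteinEllipse ρ) := by
  have h0 : z ≠ 0 := norm_pos_iff.1 ((inv_pos.2 (zero_lt_one.trans hρ)).trans hz.1)
  refine mem_interior.2 ⟨{w | ‖w - 1‖ + ‖w + 1‖ < ρ + ρ⁻¹}, fun w hw =>
    (mem_bernsteinEllipse_iff hρ.le).2 (le_of_lt hw), isOpen_lt (by fun_prop) (by fun_prop), ?_⟩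
  change ‖joukowski z - 1‖ + ‖joukowski z + 1‖ < _
  rw [norm_joukowski_sub_add h0]
  exact add_inv_lt_of_mem_Ioo hρ hz

theorem joukowski_of_norm_eq_one {z : ℂ} (hz : ‖z‖ = 1) : joukowski z = (z.re : ℂ) := by
  rw [joukowski, Complex.inv_eq_conj hz, Complex.add_conj]
  push_cast
  ring

theorem one_mem_Ioo {ρ : ℝ} (hρ : 1 < ρ) : (1 : ℝ) ∈ Ioo ρ⁻¹ ρ := ⟨inv_lt_one_of_one_lt₀ hρ, hρ⟩

end BernsteinEllipse

/-! ### Cauchy's theorem on tori: changing the radii. -/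

section ContourShift

/-- The point `exp (2 π i x)` of the unit circle. -/
noncomputable def unitExp (x : UnitAddCircle) : ℂ := (AddCircle.toCircle x : ℂ)

theorem continuous_unitExp : Continuous unitExp :=
  continuous_subtype_val.comp AddCircle.continuous_toCircle

theorem norm_unitExp (x : UnitAddCircle) : ‖unitExp x‖ = 1 := Circle.norm_coe _

theorem unitExp_zpow (x : UnitAddCircle) (n : ℤ) : unitExp x ^ n = fourier n x := by
  rw [fourier_apply, AddCircle.toCircle_zsmul, Circle.coe_zpow, unitExp]

theorem unitExp_coe (t : ℝ) : unitExp (t : UnitAddCircle) = Complex.exp ((2 * Real.pi * t : ℝ) * Complex.I) := by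
  rw [unitExp, AddCircle.toCircle_apply_mk, Circle.coe_exp, div_one]

theorem integral_comp_mul_unitExp (G : ℂ → ℂ) (s : ℝ) :
    ∫ x, G (s * unitExp x) ∂AddCircle.haarAddCircle = Real.circleAverage G 0 s := by
  rw [AddCircle.integral_haarAddCircle, inv_one, one_smul,
    ← AddCircle.intervalIntegral_preimage 1 0, zero_add, Real.circleAverage]
  have h := intervalIntegral.integral_comp_mul_left (a := 0) (b := 1)
    (fun θ => G (circleMap 0 s θ)) (c := 2 * Real.pi) (by positivity)
  rw [mul_zero, mul_one] at h
  rw [← h]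
  simp only [unitExp_coe, circleMap, zero_add]

/-- The mean is, up to a constant, the contour integral of G(z)/z, to which Cauchy's theorem on the
annulus applies. -/
theorem integral_comp_mul_unitExp_eq {G : ℂ → ℂ} {a b : ℝ} (ha : 0 < a)
    (hG : ∀ z : ℂ, ‖z‖ ∈ Ioo a b → DifferentiableAt ℂ G z) {s t : ℝ} (hs : s ∈ Ioo a b)
    (ht : t ∈ Ioo a b) :
    ∫ x, G (s * unitExp x) ∂AddCircle.haarAddCircle
      = ∫ x, G (t * unitExp x) ∂AddCircle.haarAddCircle := by
  wlog hst : s ≤ t generalizing s t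
  · exact (this ht hs (le_of_not_ge hst)).symm
  have hs0 : 0 < s := ha.trans hs.1
  have ht0 : 0 < t := ha.trans ht.1
  rw [integral_comp_mul_unitExp, integral_comp_mul_unitExp,
    Real.circleAverage_eq_circleIntegral hs0.ne', Real.circleAverage_eq_circleIntegral ht0.ne',
    Complex.circleIntegral_sub_center_inv_smul_eq_of_differentiable_on_annulus_off_countable
      hs0 hst Set.countable_empty]
  · rintro z ⟨hz1, hz2⟩
    rw [mem_closedBall_zero_iff] at hz1
    rw [mem_ball_zero_iff, not_lt] at hz2
    exact (hG z ⟨hs.1.trans_le hz2, hz1.trans_lt ht.2⟩).continuousAt.continuousWithinAt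
  · rintro z ⟨⟨hz1, hz2⟩, -⟩
    rw [mem_ball_zero_iff] at hz1
    rw [mem_closedBall_zero_iff, not_le] at hz2
    exact hG z ⟨hs.1.trans hz2, hz1.trans ht.2⟩

/-- The normalized Haar measure of the torus. -/
noncomputable def torusMeasure (k : ℕ) : Measure (Fin k → UnitAddCircle) :=
  Measure.pi fun _ => AddCircle.haarAddCircle

instance isProbabilityMeasure_torusMeasure (k : ℕ) : IsProbabilityMeasure (torusMeasure k) := by
  unfold torusMeasure; infer_instance

/-- The point of the torus with the given radii and angles. -/
noncomputable def torusPoint {k : ℕ} (s : Fin k → ℝ) (x : Fin k → UnitAddCircle) : Fin k → ℂ :=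
  fun j => s j * unitExp (x j)

theorem continuous_torusPoint {k : ℕ} (s : Fin k → ℝ) : Continuous (torusPoint s) :=
  continuous_pi fun j => continuous_const.mul (continuous_unitExp.comp (continuous_apply j))

theorem norm_torusPoint {k : ℕ} {s : Fin k → ℝ} {j : Fin k} (hs : 0 ≤ s j)
    (x : Fin k → UnitAddCircle) : ‖torusPoint s x j‖ = s j := by
  rw [torusPoint, norm_mul, norm_unitExp, mul_one, Complex.norm_real, Real.norm_of_nonneg hs]

/-- A product of annuli. -/
def polyannulus {k : ℕ} (a b : Fin k → ℝ) : Set (Fin k → ℂ) := {z | ∀ j, ‖z j‖ ∈ Ioo (a j) (b j)}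

theorem torusPoint_mem_polyannulus {k : ℕ} {a b s : Fin k → ℝ} (ha : ∀ j, 0 < a j)
    (hs : ∀ j, s j ∈ Ioo (a j) (b j)) (x : Fin k → UnitAddCircle) :
    torusPoint s x ∈ polyannulus a b := fun j => by
  rw [norm_torusPoint ((ha j).trans (hs j).1).le]
  exact hs j

theorem continuous_comp_torusPoint {k : ℕ} {Φ : (Fin k → ℂ) → ℂ} {a b s : Fin k → ℝ}
    (ha : ∀ j, 0 < a j) (hΦ : ∀ z ∈ polyannulus a b, DifferentiableAt ℂ Φ z)
    (hs : ∀ j, s j ∈ Ioo (a j) (b j)) : Continuous fun x => Φ (torusPoint s x) :=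
  continuous_iff_continuousAt.2 fun x =>
    ContinuousAt.comp (hΦ _ (torusPoint_mem_polyannulus ha hs x)).continuousAt
      (continuous_torusPoint s).continuousAt

theorem integral_torus_eq_integral_integral {k : ℕ} {F : (Fin (k + 1) → UnitAddCircle) → ℂ}
    (hF : Continuous F) (j : Fin (k + 1)) :
    ∫ x, F x ∂torusMeasure (k + 1)
      = ∫ y, ∫ x, F (Fin.insertNth (α := fun _ => UnitAddCircle) j x y) ∂AddCircle.haarAddCircle
          ∂torusMeasure k := by
  have h := (measurePreserving_piFinSuccAbove
    (fun _ : Fin (k + 1) => (AddCircle.haarAddCircle : Measure UnitAddCircle)) j).symm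
  have h1 := h.integral_comp (MeasurableEquiv.measurableEmbedding _) F
  have hc : Continuous fun p : UnitAddCircle × (Fin k → UnitAddCircle) =>
      F (Fin.insertNth (α := fun _ => UnitAddCircle) j p.1 p.2) :=
    hF.comp (Continuous.finInsertNth j continuous_fst continuous_snd)
  have h2 : Integrable (fun p : UnitAddCircle × (Fin k → UnitAddCircle) =>
      F (Fin.insertNth (α := fun _ => UnitAddCircle) j p.1 p.2))
      (AddCircle.haarAddCircle.prod (torusMeasure k)) :=
    integrableOn_univ.1 (hc.continuousOn.integrableOn_compact isCompact_univ)
  rw [← integral_prod_symm _ h2]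
  exact h1.symm

theorem integral_comp_torusPoint_update {k : ℕ} {Φ : (Fin k → ℂ) → ℂ} {a b s : Fin k → ℝ}
    (ha : ∀ j, 0 < a j) (hΦ : ∀ z ∈ polyannulus a b, DifferentiableAt ℂ Φ z)
    (hs : ∀ j, s j ∈ Ioo (a j) (b j)) (j : Fin k) {t : ℝ} (ht : t ∈ Ioo (a j) (b j)) :
    ∫ x, Φ (torusPoint (Function.update s j t) x) ∂torusMeasure k
      = ∫ x, Φ (torusPoint s x) ∂torusMeasure k := by
  obtain _ | k := k
  · exact j.elim0
  have hs' : ∀ i, Function.update s j t i ∈ Ioo (a i) (b i) := by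
    intro i
    rcases eq_or_ne i j with rfl | h
    · simpa using ht
    · simpa [h] using hs i
  rw [integral_torus_eq_integral_integral (continuous_comp_torusPoint ha hΦ hs') j,
    integral_torus_eq_integral_integral (continuous_comp_torusPoint ha hΦ hs) j]
  refine integral_congr_ae (Filter.Eventually.of_forall fun y => ?_)
  have key : ∀ (r : ℝ) (x : UnitAddCircle),
      torusPoint (Function.update s j r) (Fin.insertNth (α := fun _ => UnitAddCircle) j x y)
        = Fin.insertNth (α := fun _ => ℂ) j (r * unitExp x)
            (torusPoint (fun i => s (j.succAbove i)) y) := by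
    intro r x
    ext i
    refine Fin.succAboveCases j ?_ (fun i => ?_) i
    · simp [torusPoint]
    · simp [torusPoint]
  have key2 := key (s j)
  rw [Function.update_eq_self] at key2
  simp only [key, key2]
  refine integral_comp_mul_unitExp_eq (G := fun z => Φ (Fin.insertNth (α := fun _ => ℂ) j z
    (torusPoint (fun i => s (j.succAbove i)) y))) (ha j) (fun z hz => ?_) ht (hs j)
  have hmem : Fin.insertNth (α := fun _ => ℂ) j z
      (torusPoint (fun i => s (j.succAbove i)) y) ∈ polyannulus a b := by
    intro i
    refine Fin.succAboveCases j ?_ (fun i => ?_) i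
    · simpa using hz
    · rw [Fin.insertNth_apply_succAbove,
        norm_torusPoint (s := fun i => s (j.succAbove i)) ((ha _).trans (hs _).1).le]
      exact hs _
  refine DifferentiableAt.comp z (hΦ _ hmem) (differentiableAt_pi.2 fun i => ?_)
  refine Fin.succAboveCases j ?_ (fun i => ?_) i
  · simp
  · simp

/-- Cauchy's theorem on a product of annuli: the mean over a torus does not depend on the radii. -/
theorem integral_comp_torusPoint_eq {k : ℕ} {Φ : (Fin k → ℂ) → ℂ} {a b s t : Fin k → ℝ}
    (ha : ∀ j, 0 < a j) (hΦ : ∀ z ∈ polyannulus a b, DifferentiableAt ℂ Φ z)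
    (hs : ∀ j, s j ∈ Ioo (a j) (b j)) (ht : ∀ j, t j ∈ Ioo (a j) (b j)) :
    ∫ x, Φ (torusPoint s x) ∂torusMeasure k = ∫ x, Φ (torusPoint t x) ∂torusMeasure k := by
  -- The radii are exchanged one coordinate at a time.
  have key : ∀ S : Finset (Fin k), ∫ x, Φ (torusPoint (S.piecewise s t) x) ∂torusMeasure k
      = ∫ x, Φ (torusPoint t x) ∂torusMeasure k := by
    intro S
    induction S using Finset.induction_on with
    | empty => simp
    | insert j S _ ih =>
      rw [Finset.piecewise_insert, integral_comp_torusPoint_update ha hΦ (fun i => ?_) j (hs j), ih]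
      by_cases hi : i ∈ S
      · simpa [hi] using hs i
      · simpa [hi] using ht i
  have h := key Finset.univ
  rwa [Finset.piecewise_univ] at h

end ContourShift

/-! ### Decay of the Chebyshev coefficients and convergence of the expansion. -/

section ChebyshevCoefficients

variable {k : ℕ}

theorem polyellipse_eq_pi (ξ : Fin k → ℝ) :
    polyellipse ξ = Set.univ.pi fun j => bernsteinEllipse (ξ j) := by
  ext z
  simp [polyellipse]

theorem joukowski_mem_interior_polyellipse {ξ : Fin k → ℝ} (hξ : ∀ j, 1 < ξ j) {z : Fin k → ℂ}
    (hz : z ∈ polyannulus (fun j => (ξ j)⁻¹) ξ) :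
    (fun j => joukowski (z j)) ∈ interior (polyellipse ξ) := by
  rw [polyellipse_eq_pi, interior_pi_set Set.finite_univ]
  exact fun j _ => joukowski_mem_interior (hξ j) (hz j)

/-- The coefficients of the Chebyshev expansion, indexed by integers. -/
noncomputable def chebyshevCoeff (f : (Fin k → ℂ) → ℂ) (n : Fin k → ℤ) : ℂ :=
  ∫ x, (∏ j, unitExp (x j) ^ (-n j)) * f (fun j => joukowski (unitExp (x j))) ∂torusMeasure k

theorem differentiableAt_comp_joukowski {ξ : Fin k → ℝ} (hξ : ∀ j, 1 < ξ j)
    {f : (Fin k → ℂ) → ℂ} (hf : DifferentiableOn ℂ f (interior (polyellipse ξ)))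
    {z : Fin k → ℂ} (hz : z ∈ polyannulus (fun j => (ξ j)⁻¹) ξ) :
    DifferentiableAt ℂ (fun z : Fin k → ℂ => f fun j => joukowski (z j)) z := by
  have h0 : ∀ j, z j ≠ 0 := fun j =>
    norm_pos_iff.1 ((inv_pos.2 (zero_lt_one.trans (hξ j))).trans (hz j).1)
  refine DifferentiableAt.comp z (hf.differentiableAt
    (isOpen_interior.mem_nhds (joukowski_mem_interior_polyellipse hξ hz)))
    (differentiableAt_pi.2 fun j => ?_)
  have h1 : DifferentiableAt ℂ (fun z : Fin k → ℂ => z j) z := differentiableAt_apply j z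
  have h2 : DifferentiableAt ℂ (fun z : Fin k → ℂ => z j + (z j)⁻¹) z := h1.fun_add (h1.fun_inv (h0 j))
  simpa only [joukowski, div_eq_mul_inv] using h2.mul_const (2 : ℂ)⁻¹

theorem torusPoint_one (x : Fin k → UnitAddCircle) :
    torusPoint (fun _ => 1) x = fun j => unitExp (x j) := by
  ext j
  simp [torusPoint]

theorem chebyshevCoeff_eq_integral_torusPoint {ξ : Fin k → ℝ} (hξ : ∀ j, 1 < ξ j)
    {f : (Fin k → ℂ) → ℂ} (hf : DifferentiableOn ℂ f (interior (polyellipse ξ))) (n : Fin k → ℤ)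
    {s : Fin k → ℝ} (hs : ∀ j, s j ∈ Ioo (ξ j)⁻¹ (ξ j)) :
    chebyshevCoeff f n = ∫ x, (∏ j, torusPoint s x j ^ (-n j)) *
      f (fun j => joukowski (torusPoint s x j)) ∂torusMeasure k := by
  have ha : ∀ j, 0 < (ξ j)⁻¹ := fun j => inv_pos.2 (zero_lt_one.trans (hξ j))
  have h := integral_comp_torusPoint_eq (b := ξ)
    (Φ := fun z => (∏ j, z j ^ (-n j)) * f fun j => joukowski (z j)) ha (fun z hz => ?_)
    (fun j => one_mem_Ioo (hξ j)) hs
  · simp only [torusPoint_one] at h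
    exact h
  · refine DifferentiableAt.mul ?_ (differentiableAt_comp_joukowski hξ hf hz)
    exact (HasFDerivAt.finsetProd fun j _ => ((differentiableAt_apply j z).zpow (m := -n j)
      (Or.inl (norm_pos_iff.1 ((ha j).trans (hz j).1)))).hasFDerivAt).differentiableAt

theorem zpow_sign_mem_Ioo {t ρ : ℝ} (h1 : 1 < t) (h2 : t < ρ) (i : ℤ) :
    t ^ i.sign ∈ Ioo ρ⁻¹ ρ := by
  have hρ := h1.trans h2
  rcases lt_trichotomy i 0 with h | rfl | h
  · rw [Int.sign_eq_neg_one_of_neg h, zpow_neg_one]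
    exact ⟨inv_strictAnti₀ (zero_lt_one.trans h1) h2, (inv_lt_one_of_one_lt₀ h1).trans hρ⟩
  · simpa using one_mem_Ioo hρ
  · rw [Int.sign_eq_one_of_pos h, zpow_one]
    exact ⟨(inv_lt_one_of_one_lt₀ hρ).trans h1, h2⟩

/-- On radii t_j^{sign n_j} the factor z_j^{-n_j} has modulus t_j^{-|n_j|}. Coordinates with n_j = 0
stay on the unit circle, which J maps into [-1,1], so f need only be bounded at such points. -/
theorem norm_chebyshevCoeff_le_of_forall {ξ : Fin k → ℝ} (hξ : ∀ j, 1 < ξ j)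
    {f : (Fin k → ℂ) → ℂ} (hf : DifferentiableOn ℂ f (interior (polyellipse ξ))) (n : Fin k → ℤ)
    {B : ℝ} (hB : ∀ z : Fin k → ℂ, z ∈ polyellipse ξ →
      (∀ j, n j = 0 → ∃ t : ℝ, t ∈ Icc (-1 : ℝ) 1 ∧ z j = (t : ℂ)) → ‖f z‖ ≤ B) :
    ‖chebyshevCoeff f n‖ ≤ B * ∏ j, (ξ j ^ (n j).natAbs)⁻¹ := by
  have key : ∀ t : Fin k → ℝ, (∀ j, 1 < t j ∧ t j < ξ j) →
      ‖chebyshevCoeff f n‖ ≤ B * ∏ j, (t j ^ (n j).natAbs)⁻¹ := by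
    intro t ht
    have ht0 : ∀ j, 0 < t j := fun j => zero_lt_one.trans (ht j).1
    have hs := fun j => zpow_sign_mem_Ioo (ht j).1 (ht j).2 (n j)
    have hs0 : ∀ j, 0 ≤ t j ^ (n j).sign := fun j => zpow_nonneg (ht0 j).le _
    rw [chebyshevCoeff_eq_integral_torusPoint hξ hf n hs]
    have hmem : ∀ x, torusPoint (fun j => t j ^ (n j).sign) x
        ∈ polyannulus (fun j => (ξ j)⁻¹) ξ := fun x =>
      torusPoint_mem_polyannulus (fun j => inv_pos.2 (zero_lt_one.trans (hξ j))) hs x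
    refine (norm_integral_le_of_norm_le_const (C := B * ∏ j, (t j ^ (n j).natAbs)⁻¹)
      (Filter.Eventually.of_forall fun x => ?_)).trans (by simp)
    rw [norm_mul, mul_comm, norm_prod]
    refine mul_le_mul (hB _ (interior_subset (joukowski_mem_interior_polyellipse hξ (hmem x)))
      fun j hj => ?_) (le_of_eq ?_) (Finset.prod_nonneg fun _ _ => norm_nonneg _) ?_
    · refine ⟨(unitExp (x j)).re, ?_, ?_⟩
      · have := Complex.abs_re_le_norm (unitExp (x j))
        rw [norm_unitExp] at this
        exact abs_le.1 this
      · simp [torusPoint, hj, joukowski_of_norm_eq_one (norm_unitExp (x j))]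
    · refine Finset.prod_congr rfl fun j _ => ?_
      rw [norm_zpow, norm_torusPoint (s := fun j => t j ^ (n j).sign) (hs0 j), ← zpow_mul,
        mul_neg, Int.sign_mul_self_eq_abs, zpow_neg, Int.abs_eq_natAbs, zpow_natCast]
    · exact (norm_nonneg _).trans (hB _ (interior_subset
        (joukowski_mem_interior_polyellipse hξ (hmem x))) fun j hj => ⟨(unitExp (x j)).re, by
          have := Complex.abs_re_le_norm (unitExp (x j))
          rw [norm_unitExp] at this
          exact abs_le.1 this, by
          simp [torusPoint, hj, joukowski_of_norm_eq_one (norm_unitExp (x j))]⟩)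
  -- Holomorphy holds only in the interior, so ξ is approached by t_j = 1 + θ(ξ_j - 1) as θ ↑ 1.
  have hlim : Filter.Tendsto (fun θ : ℝ => B * ∏ j, ((1 + θ * (ξ j - 1)) ^ (n j).natAbs)⁻¹)
      (nhdsWithin 1 (Iio 1)) (nhds (B * ∏ j, (ξ j ^ (n j).natAbs)⁻¹)) := by
    have h : ContinuousAt (fun θ : ℝ => B * ∏ j, ((1 + θ * (ξ j - 1)) ^ (n j).natAbs)⁻¹) 1 := by
      refine continuousAt_const.mul (tendsto_finsetProd _ fun j _ => ?_)
      refine ContinuousAt.inv₀ (by fun_prop) (pow_ne_zero _ ?_)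
      have := hξ j
      linarith
    have h2 := h.tendsto
    simp only [one_mul, add_sub_cancel] at h2
    exact h2.mono_left nhdsWithin_le_nhds
  refine ge_of_tendsto hlim ?_
  filter_upwards [Ioo_mem_nhdsLT (show (0 : ℝ) < 1 by norm_num)] with θ hθ
  refine key _ fun j => ?_
  have := hξ j
  constructor <;> nlinarith [hθ.1, hθ.2]

theorem norm_chebyshevCoeff_le {d : ℕ} {ξ : Fin (d + 1) → ℝ} (hξ : ∀ j, 1 < ξ j)
    {f : (Fin (d + 1) → ℂ) → ℂ} (hf : DifferentiableOn ℂ f (interior (polyellipse ξ))) {M : ℝ}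
    (hM : ∀ z ∈ polyellipse ξ, ‖f z‖ ≤ M)
    (hM' : ∀ z ∈ polyellipseRealLast ξ, ‖f z‖ ≤ M / ξ (Fin.last d)) (n : Fin (d + 1) → ℤ) :
    ‖chebyshevCoeff f n‖ ≤ M * gamma ξ fun j => (n j).natAbs := by
  rw [gamma]
  by_cases h : n (Fin.last d) = 0
  · have := norm_chebyshevCoeff_le_of_forall hξ hf n (B := M / ξ (Fin.last d))
      fun z hz hz' => hM' z ⟨fun j => hz _, hz' _ h⟩
    rw [Fin.prod_univ_castSucc, h] at this
    simp only [Int.natAbs_zero, pow_zero, inv_one, mul_one] at this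
    simpa [h, div_eq_mul_inv, mul_assoc] using this
  · have := norm_chebyshevCoeff_le_of_forall hξ hf n (B := M) fun z hz _ => hM z hz
    rw [Fin.prod_univ_castSucc] at this
    rw [max_eq_right (Int.natAbs_pos.2 h)]
    simpa only [mul_comm] using this

/-- Every finite set of indices lies in a box, over which the sum factorizes. -/
theorem summable_pi_prod {ι : Type*} {g : Fin k → ι → ℝ} (h0 : ∀ j i, 0 ≤ g j i)
    (hg : ∀ j, Summable (g j)) : Summable fun n : Fin k → ι => ∏ j, g j (n j) := by
  classical
  refine summable_of_sum_le (c := ∏ j, ∑' i, g j i)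
    (fun n => Finset.prod_nonneg fun j _ => h0 j _) fun s => ?_
  have hsub : s ⊆ Fintype.piFinset fun j => s.image fun n => n j := fun n hn =>
    Fintype.mem_piFinset.2 fun j => Finset.mem_image_of_mem _ hn
  refine (Finset.sum_le_sum_of_subset_of_nonneg hsub fun n _ _ =>
    Finset.prod_nonneg fun j _ => h0 j _).trans ?_
  rw [← Finset.prod_univ_sum]
  exact Finset.prod_le_prod (fun j _ => Finset.sum_nonneg fun i _ => h0 j i)
    fun j _ => (hg j).sum_le_tsum _ fun i _ => h0 j i

theorem hasSum_chebyshevCoeff_mul_unitExp {ξ : Fin k → ℝ} (hξ : ∀ j, 1 < ξ j)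
    {f : (Fin k → ℂ) → ℂ} (hf : DifferentiableOn ℂ f (interior (polyellipse ξ)))
    (hs : Summable (chebyshevCoeff f)) (x : Fin k → UnitAddCircle) :
    HasSum (fun n : Fin k → ℤ => chebyshevCoeff f n * ∏ j, unitExp (x j) ^ n j)
      (f fun j => joukowski (unitExp (x j))) := by
  have hc := continuous_comp_torusPoint (s := fun _ => 1)
    (fun j => inv_pos.2 (zero_lt_one.trans (hξ j)))
    (fun z hz => differentiableAt_comp_joukowski hξ hf hz) (fun j => one_mem_Ioo (hξ j))
  simp only [torusPoint_one] at hc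
  have hcoeff : UnitAddTorus.mFourierCoeff (fun x : UnitAddTorus (Fin k) =>
      f fun j => joukowski (unitExp (x j))) = chebyshevCoeff f := by
    ext n
    refine Eq.trans ?_ (show ∫ x, UnitAddTorus.mFourier (-n) x *
      f (fun j => joukowski (unitExp (x j))) ∂torusMeasure k = _ from ?_)
    · rfl
    · simp only [chebyshevCoeff, unitExp_zpow]
      rfl
  have h := UnitAddTorus.hasSum_mFourier_series_apply_of_summable
    (f := (⟨_, hc⟩ : C(UnitAddTorus (Fin k), ℂ))) (hcoeff ▸ hs) x
  rw [ContinuousMap.coe_mk, hcoeff] at h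
  refine h.congr_fun ?_
  intro n
  simp only [unitExp_zpow, smul_eq_mul]
  rfl

theorem unitExp_neg (x : UnitAddCircle) : unitExp (-x) = (unitExp x)⁻¹ := by
  rw [unitExp, AddCircle.toCircle_neg, Circle.coe_inv, unitExp]

/-- The Chebyshev expansion of a function that is holomorphic near the cube. -/
theorem hasSum_chebyshevCoeff_mul_T {ξ : Fin k → ℝ} (hξ : ∀ j, 1 < ξ j)
    {f : (Fin k → ℂ) → ℂ} (hf : DifferentiableOn ℂ f (interior (polyellipse ξ)))
    (hs : Summable (chebyshevCoeff f)) {y : Fin k → ℝ} (hy : ∀ j, y j ∈ Icc (-1 : ℝ) 1) :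
    HasSum (fun n : Fin k → ℤ =>
      chebyshevCoeff f n * ((∏ j, (Chebyshev.T ℝ (n j)).eval (y j) : ℝ) : ℂ))
      (f (toComplex y)) := by
  classical
  let x : Fin k → UnitAddCircle := fun j => ((Real.arccos (y j) / (2 * Real.pi) : ℝ) : UnitAddCircle)
  have hx : ∀ j, unitExp (x j) = Complex.exp (Real.arccos (y j) * Complex.I) := by
    intro j
    rw [unitExp_coe, mul_div_cancel₀ _ (by positivity)]
  have hJ : ∀ j, joukowski (unitExp (x j)) = y j := by
    intro j
    rw [joukowski_of_norm_eq_one (norm_unitExp _), hx, Complex.exp_ofReal_mul_I_re,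
      Real.cos_arccos (hy j).1 (hy j).2]
  have hT : ∀ j (i : ℤ), unitExp (x j) ^ i + unitExp (x j) ^ (-i)
      = 2 * (((Chebyshev.T ℝ i).eval (y j) : ℝ) : ℂ) := by
    intro j i
    conv_rhs => rw [← Real.cos_arccos (hy j).1 (hy j).2]
    rw [Chebyshev.T_real_cos, hx, ← Complex.exp_int_mul, ← Complex.exp_int_mul, Complex.ofReal_cos,
      Complex.two_cos]
    push_cast
    congr 2 <;> ring
  -- As J(z⁻¹) = J(z), flipping signs of angles does not change the value of f. Averaging the
  -- Fourier series over all 2^k flips turns each exponential into a product of cosines, that is, of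
  -- Chebyshev polynomials.
  let σ : Finset (Fin k) → Fin k → UnitAddCircle := fun t j => if j ∈ t then x j else -x j
  have hσ : ∀ t, f (fun j => joukowski (unitExp (σ t j))) = f (toComplex y) := by
    intro t
    congr 1
    ext j
    by_cases h : j ∈ t
    · simp [σ, h, hJ, toComplex]
    · simp [σ, h, hJ, toComplex, unitExp_neg, joukowski_inv]
  have h := hasSum_sum (s := (Finset.univ : Finset (Fin k)).powerset)
    fun t _ => hasSum_chebyshevCoeff_mul_unitExp hξ hf hs (σ t)
  have h2 : (2 : ℂ) ^ k ≠ 0 := pow_ne_zero _ two_ne_zero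
  have h3 := h.mul_left ((2 : ℂ) ^ k)⁻¹
  simp only [hσ, Finset.sum_const, Finset.card_powerset, Finset.card_univ, Fintype.card_fin,
    nsmul_eq_mul, Nat.cast_pow, Nat.cast_ofNat] at h3
  rw [inv_mul_cancel_left₀ h2] at h3
  refine h3.congr_fun fun n => ?_
  rw [← Finset.mul_sum]
  have h4 : ∑ t ∈ (Finset.univ : Finset (Fin k)).powerset, ∏ j, unitExp (σ t j) ^ n j
      = 2 ^ k * ((∏ j, (Chebyshev.T ℝ (n j)).eval (y j) : ℝ) : ℂ) := by
    rw [Complex.ofReal_prod, ← Fin.prod_const, ← Finset.prod_mul_distrib]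
    simp only [← hT]
    rw [Finset.prod_add]
    refine Finset.sum_congr rfl fun t _ => ?_
    rw [← Finset.prod_mul_prod_compl t, Finset.compl_eq_univ_sdiff]
    congr 1
    · exact Finset.prod_congr rfl fun j hj => by simp [σ, hj]
    · refine Finset.prod_congr rfl fun j hj => ?_
      simp [σ, (Finset.mem_sdiff.1 hj).2, unitExp_neg]
  rw [h4]
  field_simp

end ChebyshevCoefficients

/-! ### From Chebyshev to Legendre: connection coefficients and remainders. -/

section Tensor

open Polynomial.Chebyshev

variable {k : ℕ}

instance isProbabilityMeasure_mu (k : ℕ) : IsProbabilityMeasure (mu k) := by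
  unfold mu; infer_instance

theorem ae_mu_mem_Icc (k : ℕ) : ∀ᵐ y ∂mu k, ∀ j, y j ∈ Icc (-1 : ℝ) 1 :=
  ae_all_iff.2 fun j => (Measure.tendsto_eval_ae_ae (μ := fun _ : Fin k => mu1) (i := j)).eventually
    ae_mu1_mem_Icc

theorem _root_.Continuous.integrable_mu {E : Type*} [NormedAddCommGroup E]
    {g : (Fin k → ℝ) → E} (hg : Continuous g) : Integrable g (mu k) := by
  obtain ⟨C, hC⟩ := (isCompact_univ_pi fun _ : Fin k =>
    (isCompact_Icc : IsCompact (Icc (-1 : ℝ) 1))).exists_bound_of_continuousOn hg.continuousOn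
  refine Integrable.of_bound hg.aestronglyMeasurable C ?_
  filter_upwards [ae_mu_mem_Icc k] with y hy
  exact hC y fun j _ => hy j

/-- The Legendre coefficients of a product of Chebyshev polynomials. -/
noncomputable def connectionCoeff (n : Fin k → ℤ) (ν : Fin k → ℕ) : ℝ :=
  ∏ j, legendreFunctional (ν j) (T ℝ (n j))

theorem abs_connectionCoeff_le_one (n : Fin k → ℤ) (ν : Fin k → ℕ) :
    |connectionCoeff n ν| ≤ 1 := by
  rw [connectionCoeff, Finset.abs_prod]
  exact Finset.prod_le_one (fun _ _ => abs_nonneg _) fun j _ =>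
    abs_legendreFunctional_le_one _ fun x hx => abs_eval_T_real_le_one _ (abs_le.2 hx)

theorem connectionCoeff_eq_zero {n : Fin k → ℤ} {ν : Fin k → ℕ}
    (h : ¬ν ≤ fun j => (n j).natAbs) : connectionCoeff n ν = 0 := by
  rw [Pi.le_def, not_forall] at h
  obtain ⟨j, hj⟩ := h
  refine Finset.prod_eq_zero (Finset.mem_univ j) (legendreFunctional_eq_zero ?_)
  rw [natDegree_T]
  exact not_le.1 hj

theorem hasSum_legendreCoeff {f : (Fin k → ℂ) → ℂ} {c : (Fin k → ℤ) → ℂ} (hc : Summable c)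
    (hf : ∀ y : Fin k → ℝ, (∀ j, y j ∈ Icc (-1 : ℝ) 1) →
      HasSum (fun n => c n * ((∏ j, (T ℝ (n j)).eval (y j) : ℝ) : ℂ)) (f (toComplex y)))
    (ν : Fin k → ℕ) : HasSum (fun n => c n * (connectionCoeff n ν : ℂ)) (legendreCoeff f ν) := by
  have hL : Continuous fun y : Fin k → ℝ => legendreTensor ν y :=
    continuous_finsetProd _ fun j _ => (legendre (ν j)).continuous.comp (continuous_apply j)
  have hT : ∀ n : Fin k → ℤ, Continuous fun y : Fin k → ℝ => ∏ j, (T ℝ (n j)).eval (y j) :=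
    fun n => continuous_finsetProd _ fun j _ => (T ℝ (n j)).continuous.comp (continuous_apply j)
  let F : (Fin k → ℤ) → (Fin k → ℝ) → ℂ := fun n y =>
    c n * ((∏ j, (T ℝ (n j)).eval (y j) : ℝ) : ℂ) * (legendreTensor ν y : ℂ)
  have hF : ∀ n, Continuous (F n) := fun n =>
    (continuous_const.mul (Complex.continuous_ofReal.comp (hT n))).mul
      (Complex.continuous_ofReal.comp hL)
  have hsum : Summable fun n => ∫ y, ‖F n y‖ ∂mu k := by
    refine Summable.of_nonneg_of_le (fun n => integral_nonneg fun _ => norm_nonneg _) (fun n => ?_)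
      (hc.norm.mul_right (∫ y, ‖legendreTensor ν y‖ ∂mu k))
    rw [← integral_const_mul]
    refine integral_mono_ae (hF n).norm.integrable_mu (hL.norm.const_mul _).integrable_mu ?_
    filter_upwards [ae_mu_mem_Icc k] with y hy
    simp only [F, norm_mul, Complex.norm_real, norm_prod]
    refine mul_le_mul_of_nonneg_right (mul_le_of_le_one_right (norm_nonneg _) ?_) (norm_nonneg _)
    exact Finset.prod_le_one (fun _ _ => norm_nonneg _) fun j _ =>
      abs_eval_T_real_le_one _ (abs_le.2 (hy j))
  have h := hasSum_integral_of_summable_integral_norm (fun n => (hF n).integrable_mu) hsum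
  have h1 : ∫ y, ∑' n, F n y ∂mu k = legendreCoeff f ν := by
    refine integral_congr_ae ?_
    filter_upwards [ae_mu_mem_Icc k] with y hy
    exact ((hf y hy).mul_right (legendreTensor ν y : ℂ)).tsum_eq
  rw [h1] at h
  refine h.congr_fun fun n => ?_
  simp only [F, legendreTensor, mul_assoc, ← Complex.ofReal_mul, ← Finset.prod_mul_distrib]
  rw [integral_const_mul, integral_complex_ofReal, mu, connectionCoeff,
    integral_fintype_prod_eq_prod (fun j x => (T ℝ (n j)).eval x * (legendre (ν j)).eval x)]
  rfl

/-- The product of Chebyshev polynomials minus the part of its Legendre expansion in `s`. -/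
noncomputable def remainderJet (s : Finset (Fin k → ℕ)) (n : Fin k → ℤ) (α : Fin k → ℕ)
    (y : Fin k → ℝ) : ℂ :=
  polyTensor (fun j => T ℝ (n j)) α y -
    ∑ ν ∈ s, (connectionCoeff n ν : ℂ) * polyTensor (fun j => legendre (ν j)) α y

theorem isJet_remainderJet (s : Finset (Fin k → ℕ)) (n : Fin k → ℤ) (U : Set (Fin k → ℝ)) :
    IsJet (remainderJet s n) U :=
  (isJet_polyTensor _ U).sub (IsJet.sum s fun _ _ => (isJet_polyTensor _ U).const_mul _)

theorem polyTensor_T_eq_sum (n : Fin k → ℤ) (α : Fin k → ℕ) (y : Fin k → ℝ) :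
    polyTensor (fun j => T ℝ (n j)) α y
      = ∑ ν ∈ Fintype.piFinset fun j => Finset.range ((n j).natAbs + 1),
        (connectionCoeff n ν : ℂ) * polyTensor (fun j => legendre (ν j)) α y := by
  have h : ∀ j, (derivative^[α j] (T ℝ (n j))).eval (y j)
      = ∑ i ∈ Finset.range ((n j).natAbs + 1), legendreFunctional i (T ℝ (n j)) *
        (derivative^[α j] (legendre i)).eval (y j) := by
    intro j
    conv_lhs => rw [eq_sum_legendre (natDegree_T ℝ (n j)).le]
    rw [iterate_derivative_sum, eval_finsetSum]
    simp only [iterate_derivative_smul, eval_smul, smul_eq_mul]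
  simp only [polyTensor, h, Finset.prod_univ_sum, connectionCoeff, Finset.prod_mul_distrib]
  push_cast
  rfl

theorem mem_piFinset_range_iff {n : Fin k → ℤ} {ν : Fin k → ℕ} :
    ν ∈ (Fintype.piFinset fun j => Finset.range ((n j).natAbs + 1)) ↔
      ν ≤ fun j => (n j).natAbs := by
  simp [Fintype.mem_piFinset, Pi.le_def]

/-- A lower set containing |n| contains every ν ≤ |n|, hence the whole Legendre expansion. -/
theorem remainderJet_eq_zero {s : Finset (Fin k → ℕ)} (hs : IsLowerSet (s : Set (Fin k → ℕ)))
    {n : Fin k → ℤ} (hn : (fun j => (n j).natAbs) ∈ s) (α : Fin k → ℕ) (y : Fin k → ℝ) :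
    remainderJet s n α y = 0 := by
  rw [remainderJet, polyTensor_T_eq_sum, sub_eq_zero]
  refine Finset.sum_subset (fun ν hν => hs (mem_piFinset_range_iff.1 hν) hn) fun ν _ hν => ?_
  rw [connectionCoeff_eq_zero (mt mem_piFinset_range_iff.2 hν), Complex.ofReal_zero, zero_mul]

/-- The bound is uniform in s: only the ν ≤ |n| contribute, with coefficients at most 1, and the sum
of absolute values over that box factorizes. The |n_j| + 1 indices per coordinate raise the exponent
from 2r + 3 to 2r + 4. -/
theorem norm_remainderJet_le (s : Finset (Fin k → ℕ)) (n : Fin k → ℤ) {α : Fin k → ℕ} {r : ℕ}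
    (hα : ∀ j, α j ≤ r) {y : Fin k → ℝ} (hy : ∀ j, y j ∈ Icc (-1 : ℝ) 1) :
    ‖remainderJet s n α y‖ ≤ 2 * ∏ j, (2 * (((n j).natAbs : ℝ) + 1) ^ (2 * r + 4)) := by
  classical
  have hT : ‖polyTensor (fun j => T ℝ (n j)) α y‖
      ≤ ∏ j, (2 * (((n j).natAbs : ℝ) + 1) ^ (2 * r + 4)) := by
    rw [polyTensor, Complex.norm_real, norm_prod]
    refine Finset.prod_le_prod (fun _ _ => norm_nonneg _) fun j _ => ?_
    have h1 := abs_iterate_derivative_T_le (n j).natAbs (α j) (hy j)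
    rw [T_natAbs] at h1
    have h2 := hα j
    calc _ ≤ _ := h1
      _ ≤ (((n j).natAbs : ℝ) + 1) ^ (2 * α j) := by gcongr; linarith
      _ ≤ (((n j).natAbs : ℝ) + 1) ^ (2 * r + 4) :=
        pow_le_pow_right₀ (by simp) (by omega)
      _ ≤ _ := le_mul_of_one_le_left (by positivity) one_le_two
  have hL : ‖∑ ν ∈ s, (connectionCoeff n ν : ℂ) * polyTensor (fun j => legendre (ν j)) α y‖
      ≤ ∏ j, (2 * (((n j).natAbs : ℝ) + 1) ^ (2 * r + 4)) := by
    have h1 : ∑ ν ∈ s, (connectionCoeff n ν : ℂ) * polyTensor (fun j => legendre (ν j)) α y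
        = ∑ ν ∈ s with ν ≤ fun j => (n j).natAbs,
          (connectionCoeff n ν : ℂ) * polyTensor (fun j => legendre (ν j)) α y := by
      refine (Finset.sum_filter_of_ne fun ν _ hν => ?_).symm
      by_contra h
      rw [connectionCoeff_eq_zero h] at hν
      simp at hν
    rw [h1]
    calc _ ≤ ∑ ν ∈ s with ν ≤ fun j => (n j).natAbs,
          ∏ j, |(derivative^[α j] (legendre (ν j))).eval (y j)| := by
          refine (norm_sum_le _ _).trans (Finset.sum_le_sum fun ν _ => ?_)
          rw [norm_mul, polyTensor, Complex.norm_real, Complex.norm_real, norm_prod]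
          exact mul_le_of_le_one_left (Finset.prod_nonneg fun _ _ => norm_nonneg _)
            (abs_connectionCoeff_le_one n ν)
      _ ≤ ∑ ν ∈ Fintype.piFinset fun j => Finset.range ((n j).natAbs + 1),
          ∏ j, |(derivative^[α j] (legendre (ν j))).eval (y j)| := by
          refine Finset.sum_le_sum_of_subset_of_nonneg (fun ν hν => ?_) fun _ _ _ =>
            Finset.prod_nonneg fun _ _ => abs_nonneg _
          exact mem_piFinset_range_iff.2 (Finset.mem_filter.1 hν).2
      _ = ∏ j, ∑ i ∈ Finset.range ((n j).natAbs + 1),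
          |(derivative^[α j] (legendre i)).eval (y j)| := by
          rw [Finset.prod_univ_sum]
      _ ≤ _ := by
          refine Finset.prod_le_prod (fun _ _ => Finset.sum_nonneg fun _ _ => abs_nonneg _)
            fun j _ => ?_
          have h2 : ∀ i ∈ Finset.range ((n j).natAbs + 1),
              |(derivative^[α j] (legendre i)).eval (y j)|
                ≤ 2 * (((n j).natAbs : ℝ) + 1) ^ (2 * r + 3) := by
            intro i hi
            have h3 : (i : ℝ) ≤ (n j).natAbs := by
              exact_mod_cast Nat.lt_succ_iff.1 (Finset.mem_range.1 hi)
            have h4 := hα j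
            refine (abs_iterate_derivative_legendre_le i (α j) (hy j)).trans ?_
            gcongr
            calc ((i : ℝ) + 1) ^ (2 * α j + 3) ≤ (((n j).natAbs : ℝ) + 1) ^ (2 * α j + 3) := by
                  gcongr
              _ ≤ _ := pow_le_pow_right₀ (by simp) (by omega)
          refine (Finset.sum_le_card_nsmul _ _ _ h2).trans (le_of_eq ?_)
          rw [Finset.card_range, nsmul_eq_mul]
          push_cast
          ring
  calc _ ≤ _ := norm_sub_le _ _
    _ ≤ _ := add_le_add hT hL
    _ = _ := (two_mul _).symm

end Tensor

/-! ### Monotonicity of γ and its splitting between ε and summability. -/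

section Gamma

variable {d : ℕ} {ξ : Fin (d + 1) → ℝ}

theorem gamma_pos (hξ : ∀ j, 1 < ξ j) (ν : Fin (d + 1) → ℕ) : 0 < gamma ξ ν :=
  mul_pos (inv_pos.2 (pow_pos (zero_lt_one.trans (hξ _)) _))
    (Finset.prod_pos fun _ _ => inv_pos.2 (pow_pos (zero_lt_one.trans (hξ _)) _))

theorem gamma_antitone (hξ : ∀ j, 1 < ξ j) : Antitone (gamma ξ) := by
  intro ν ν' h
  have h0 : ∀ j, 0 < ξ j := fun j => zero_lt_one.trans (hξ j)
  refine mul_le_mul (inv_anti₀ (pow_pos (h0 _) _) (pow_le_pow_right₀ (hξ _).le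
    (max_le_max le_rfl (h _)))) (Finset.prod_le_prod
      (fun _ _ => inv_nonneg.2 (pow_nonneg (h0 _).le _)) fun j _ =>
        inv_anti₀ (pow_pos (h0 _) _) (pow_le_pow_right₀ (hξ _).le (h _)))
    (Finset.prod_nonneg fun _ _ => inv_nonneg.2 (pow_nonneg (h0 _).le _))
    (inv_nonneg.2 (pow_nonneg (h0 _).le _))

theorem gamma_le_prod_pow (hξ : ∀ j, 1 < ξ j) {a : ℝ} (ha : 0 < a) (haξ : ∀ j, a ≤ ξ j)
    (ν : Fin (d + 1) → ℕ) : gamma ξ ν ≤ ∏ j, a⁻¹ ^ ν j := by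
  refine (gamma_le_prod hξ ν).trans (Finset.prod_le_prod
    (fun j _ => inv_nonneg.2 (pow_nonneg (zero_le_one.trans (hξ j).le) _)) fun j _ => ?_)
  rw [inv_pow]
  exact inv_anti₀ (pow_pos ha _) (pow_le_pow_left₀ ha.le (haξ j) _)

/-- The power τ of γ is spent on ε; the power 1 - τ is kept as geometric decay that depends on ξ
only through a. -/
theorem gamma_le_rpow_mul_prod (hξ : ∀ j, 1 < ξ j) {a : ℝ} (ha : 0 < a) (haξ : ∀ j, a ≤ ξ j)
    {τ : ℝ} (hτ : τ ∈ Ioo (0 : ℝ) 1) {ε : ℝ} {ν : Fin (d + 1) → ℕ} (hν : gamma ξ ν ≤ ε) :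
    gamma ξ ν ≤ ε ^ τ * ∏ j, (a⁻¹ ^ (1 - τ)) ^ ν j := by
  have h0 := gamma_pos hξ ν
  calc gamma ξ ν = gamma ξ ν ^ τ * gamma ξ ν ^ (1 - τ) := by
        rw [← Real.rpow_add h0, add_sub_cancel, Real.rpow_one]
    _ ≤ ε ^ τ * (∏ j, a⁻¹ ^ ν j) ^ (1 - τ) := by
        have h1 := hτ.1.le
        have h2 : 0 ≤ 1 - τ := by linarith [hτ.2]
        have h3 : 0 ≤ ε := h0.le.trans hν
        exact mul_le_mul (Real.rpow_le_rpow h0.le hν h1)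
          (Real.rpow_le_rpow h0.le (gamma_le_prod_pow hξ ha haξ ν) h2)
          (Real.rpow_nonneg h0.le _) (Real.rpow_nonneg h3 _)
    _ = _ := by
        congr 1
        rw [Finset.prod_pow_eq_pow_sum, Finset.prod_pow_eq_pow_sum, ← Real.rpow_natCast,
          ← Real.rpow_natCast, ← Real.rpow_mul (inv_nonneg.2 ha.le),
          ← Real.rpow_mul (inv_nonneg.2 ha.le), mul_comm]

end Gamma

/-! ### Summability of the polynomial times geometric weights. -/

section Summability

theorem summable_natAbs_pow_mul_geometric (p : ℕ) {q : ℝ} (hq0 : 0 < q) (hq1 : q < 1) :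
    Summable fun i : ℤ => 2 * ((i.natAbs : ℝ) + 1) ^ p * q ^ i.natAbs := by
  have h : Summable fun i : ℕ => 2 * ((i : ℝ) + 1) ^ p * q ^ i := by
    have h1 := (summable_nat_add_iff 1).2 (summable_pow_mul_geometric_of_norm_lt_one p
      (r := q) (by rwa [Real.norm_of_nonneg hq0.le]))
    refine (h1.mul_left (2 * q⁻¹)).congr fun i => ?_
    push_cast
    field_simp
    ring
  refine Summable.of_nat_of_neg ?_ ?_
  · simpa using h
  · simpa using h

theorem summable_weight (k r : ℕ) {q : ℝ} (hq0 : 0 < q) (hq1 : q < 1) :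
    Summable fun n : Fin k → ℤ =>
      ∏ j, (2 * (((n j).natAbs : ℝ) + 1) ^ (2 * r + 4) * q ^ (n j).natAbs) :=
  summable_pi_prod (ι := ℤ) (g := fun _ i => 2 * ((i.natAbs : ℝ) + 1) ^ (2 * r + 4) * q ^ i.natAbs)
    (fun _ i => mul_nonneg (by positivity) (pow_nonneg hq0.le _))
    fun _ => summable_natAbs_pow_mul_geometric (2 * r + 4) hq0 hq1

end Summability

/-! ### The truncation error as a dominated series. -/

section TruncationError

variable {d : ℕ} {ξ : Fin (d + 1) → ℝ}

theorem isLowerSet_indexSet (hξ : ∀ j, 1 < ξ j) (ε : ℝ) : IsLowerSet (indexSet ξ ε) :=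
  fun _ _ h hν => le_trans (show ε ≤ _ from hν) (gamma_antitone hξ h)

theorem polyellipseRealLast_subset (hξ : ∀ j, 1 < ξ j) :
    polyellipseRealLast ξ ⊆ polyellipse ξ := by
  rintro z ⟨hz, t, ht, hzt⟩ j
  refine Fin.lastCases ?_ hz j
  rw [hzt, mem_bernsteinEllipse_iff (hξ _).le]
  have h0 : 0 < ξ (Fin.last d) := zero_lt_one.trans (hξ _)
  have h1 : ‖(t : ℂ) - 1‖ = 1 - t := by
    rw [← Complex.ofReal_one, ← Complex.ofReal_sub, Complex.norm_real, Real.norm_eq_abs,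
      abs_of_nonpos (by linarith [ht.2])]
    ring
  have h2 : ‖(t : ℂ) + 1‖ = t + 1 := by
    rw [← Complex.ofReal_one, ← Complex.ofReal_add, Complex.norm_real, Real.norm_eq_abs,
      abs_of_nonneg (by linarith [ht.1])]
  have := add_inv_lt_of_mem_Ioo (hξ (Fin.last d)) (one_mem_Ioo (hξ _))
  rw [inv_one] at this
  rw [h1, h2]
  linarith

theorem norm_le_supNormOn {k : ℕ} {f : (Fin k → ℂ) → ℂ} {O : Set (Fin k → ℂ)} {r : ℝ}
    (hr : ∀ z ∈ O, f z ∈ Metric.ball (0 : ℂ) r) {z : Fin k → ℂ} (hz : z ∈ O) :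
    ‖f z‖ ≤ supNormOn f O :=
  le_ciSup (f := fun z : O => ‖f z‖)
    ⟨r, by rintro _ ⟨w, rfl⟩; exact (mem_ball_zero_iff.1 (hr w w.2)).le⟩ ⟨z, hz⟩

/-- The truncation error as a series over the Chebyshev expansion. -/
theorem truncationError_eq_tsum (hξ : ∀ j, 1 < ξ j) {f : (Fin (d + 1) → ℂ) → ℂ}
    (hf : DifferentiableOn ℂ f (interior (polyellipse ξ))) (hs : Summable (chebyshevCoeff f))
    {Λ : Set (Fin (d + 1) → ℕ)} (hΛ : Λ.Finite) {y : Fin (d + 1) → ℝ}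
    (hy : ∀ j, y j ∈ Icc (-1 : ℝ) 1) :
    truncationError f Λ y = ∑' n, chebyshevCoeff f n * remainderJet hΛ.toFinset n 0 y := by
  have h1 := fun (y : Fin (d + 1) → ℝ) (hy : ∀ j, y j ∈ Icc (-1 : ℝ) 1) => hasSum_chebyshevCoeff_mul_T hξ hf hs hy
  have h2 : HasSum (fun n => ∑ ν ∈ hΛ.toFinset, chebyshevCoeff f n * (connectionCoeff n ν : ℂ) *
      (legendreTensor ν y : ℂ)) (∑ ν ∈ hΛ.toFinset, legendreCoeff f ν * (legendreTensor ν y : ℂ)) :=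
    hasSum_sum fun ν _ => (hasSum_legendreCoeff hs h1 ν).mul_right _
  rw [truncationError, finsum_mem_eq_finite_toFinset_sum _ hΛ, ← ((h1 y hy).sub h2).tsum_eq]
  refine tsum_congr fun n => ?_
  simp only [remainderJet, polyTensor, Pi.zero_apply, Function.iterate_zero, id, mul_sub,
    Finset.mul_sum, legendreTensor, mul_assoc]

theorem norm_chebyshevCoeff_mul_remainderJet_le (hξ : ∀ j, 1 < ξ j) {a : ℝ} (ha : 0 < a)
    (haξ : ∀ j, a ≤ ξ j) {τ : ℝ} (hτ : τ ∈ Ioo (0 : ℝ) 1) {ε : ℝ} (hε : 0 < ε)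
    {f : (Fin (d + 1) → ℂ) → ℂ} {M : ℝ} (hM : 0 ≤ M) {n : Fin (d + 1) → ℤ}
    (hc : ‖chebyshevCoeff f n‖ ≤ M * gamma ξ fun j => (n j).natAbs) {α : Fin (d + 1) → ℕ}
    {r : ℕ} (hα : ∀ j, α j ≤ r) {y : Fin (d + 1) → ℝ} (hy : ∀ j, y j ∈ Icc (-1 : ℝ) 1) :
    ‖chebyshevCoeff f n * remainderJet (finite_indexSet hξ hε).toFinset n α y‖
      ≤ 2 * M * ε ^ τ * ∏ j, (2 * (((n j).natAbs : ℝ) + 1) ^ (2 * r + 4) *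
        (a⁻¹ ^ (1 - τ)) ^ (n j).natAbs) := by
  have hq : 0 ≤ a⁻¹ ^ (1 - τ) := Real.rpow_nonneg (inv_nonneg.2 ha.le) _
  by_cases hn : (fun j => (n j).natAbs) ∈ indexSet ξ ε
  · rw [remainderJet_eq_zero (by simpa using isLowerSet_indexSet hξ ε)
      ((finite_indexSet hξ hε).mem_toFinset.2 hn), mul_zero, norm_zero]
    positivity
  · rw [norm_mul, Finset.prod_mul_distrib]
    have h1 := gamma_le_rpow_mul_prod hξ ha haξ hτ (not_le.1 (show ¬ ε ≤ _ from hn)).le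
    have h2 := norm_remainderJet_le (finite_indexSet hξ hε).toFinset n hα hy
    calc _ ≤ (M * (ε ^ τ * ∏ j, (a⁻¹ ^ (1 - τ)) ^ (n j).natAbs)) *
          (2 * ∏ j, (2 * (((n j).natAbs : ℝ) + 1) ^ (2 * r + 4))) :=
        mul_le_mul (hc.trans (mul_le_mul_of_nonneg_left h1 hM)) h2 (norm_nonneg _) (by positivity)
      _ = _ := by ring

theorem rpow_one_sub_mem_Ioo {a τ : ℝ} (ha : 1 < a) (hτ : τ ∈ Ioo (0 : ℝ) 1) :
    a⁻¹ ^ (1 - τ) ∈ Ioo (0 : ℝ) 1 :=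
  ⟨Real.rpow_pos_of_pos (inv_pos.2 (zero_lt_one.trans ha)) _,
    Real.rpow_lt_one (inv_nonneg.2 (zero_le_one.trans ha.le)) (inv_lt_one_of_one_lt₀ ha)
      (by linarith [hτ.2])⟩

theorem summable_chebyshevCoeff (hξ : ∀ j, 1 < ξ j) {f : (Fin (d + 1) → ℂ) → ℂ} {M : ℝ}
    (hc : ∀ n, ‖chebyshevCoeff f n‖ ≤ M * gamma ξ fun j => (n j).natAbs) (hM : 0 ≤ M) :
    Summable (chebyshevCoeff f) := by
  have h : Summable fun n : Fin (d + 1) → ℤ => ∏ j, (ξ j)⁻¹ ^ (n j).natAbs := by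
    refine summable_pi_prod (g := fun j (i : ℤ) => (ξ j)⁻¹ ^ i.natAbs)
      (fun j i => pow_nonneg (inv_nonneg.2 (zero_le_one.trans (hξ j).le)) _) fun j => ?_
    have h1 := summable_geometric_of_lt_one (inv_nonneg.2 (zero_le_one.trans (hξ j).le))
      (inv_lt_one_of_one_lt₀ (hξ j))
    exact Summable.of_nat_of_neg (by simpa using h1) (by simpa using h1)
  refine Summable.of_norm_bounded (h.mul_left M) fun n => (hc n).trans
    (mul_le_mul_of_nonneg_left ((gamma_le_prod hξ _).trans (le_of_eq ?_)) hM)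
  simp only [inv_pow]

theorem mem_Icc_of_mem_openCube {k : ℕ} {y : Fin k → ℝ} (hy : y ∈ openCube k) (j : Fin k) :
    y j ∈ Icc (-1 : ℝ) 1 := Ioo_subset_Icc_self (hy j (Set.mem_univ j))

end TruncationError

end LegendreApprox
-- Assembly of the main estimate.
theorem mainTheorem9
    (d m : ℕ) (τ : ℝ) (hτ : τ ∈ Set.Ioo (0 : ℝ) 1) (ξmin : ℝ) :
    ∃ C : ℝ, 0 < C ∧
      ∀ ξ : Fin (d + 1) → ℝ, (∀ j, 1 < ξ j) → (⨅ j, ξ j) = ξmin →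
      ∀ r : ℝ, 0 < r →
      ∀ f : (Fin (d + 1) → ℂ) → ℂ,
        LegendreApprox.HolomorphicC1On f (LegendreApprox.polyellipse ξ) →
        (∀ z ∈ LegendreApprox.polyellipse ξ, f z ∈ Metric.ball (0 : ℂ) r) →
        (∀ z ∈ LegendreApprox.polyellipseRealLast ξ,
          f z ∈ Metric.ball (0 : ℂ) (r / ξ (Fin.last d))) →
      ∀ ε : ℝ, 0 < ε → ε < (ξ (Fin.last d))⁻¹ →
        (LegendreApprox.indexSet ξ ε).Finite ∧
        ContDiffOn ℝ (m : ℕ∞)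
          (LegendreApprox.truncationError f (LegendreApprox.indexSet ξ ε))
          (LegendreApprox.openCube (d + 1)) ∧
        LegendreApprox.sobolevNorm m
            (LegendreApprox.truncationError f (LegendreApprox.indexSet ξ ε))
          ≤ ENNReal.ofReal (C * ε ^ τ *
              min r (ξ (Fin.last d) *
                LegendreApprox.supNormOn f (LegendreApprox.polyellipse ξ))) ∧
        C * ε ^ τ *
            min r (ξ (Fin.last d) *
              LegendreApprox.supNormOn f (LegendreApprox.polyellipse ξ))
          ≤ C * Real.exp (-τ * LegendreApprox.beta ξ *
                ((LegendreApprox.indexSet ξ ε).ncard : ℝ) ^ (1 / ((d + 1 : ℕ) : ℝ))) *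
              min r (ξ (Fin.last d) *
                LegendreApprox.supNormOn f (LegendreApprox.polyellipse ξ)) *
              ∏ j, ξ j := by
  -- If ξmin ≤ 1, no admissible ξ has this minimum, and any constant will do.
  by_cases h1 : 1 < ξmin
  swap
  · refine ⟨1, one_pos, fun ξ hξ hmin => absurd ?_ h1⟩
    obtain ⟨j, hj⟩ := exists_eq_ciInf_of_finite (f := ξ)
    rw [← hmin, ← hj]
    exact hξ j
  have h0 : 0 < ξmin := zero_lt_one.trans h1
  have hq := LegendreApprox.rpow_one_sub_mem_Ioo h1 hτ
  set q := ξmin⁻¹ ^ (1 - τ)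
  let S : ℝ := ∑' n : Fin (d + 1) → ℤ,
    ∏ j, (2 * (((n j).natAbs : ℝ) + 1) ^ (2 * m + 4) * q ^ (n j).natAbs)
  have hS : 0 ≤ S := tsum_nonneg fun n => Finset.prod_nonneg fun j _ =>
    mul_nonneg (by positivity) (pow_nonneg hq.1.le _)
  -- The series bound is 2 S M ε^τ; the added 1 makes the constant visibly positive.
  refine ⟨2 * S + 1, by positivity, fun ξ hξ hmin r hr f hf hfr hfr' ε hε hε1 => ?_⟩
  have hξmin : ∀ j, ξmin ≤ ξ j := fun j => hmin ▸ ciInf_le (Set.finite_range ξ).bddBelow j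
  set N := LegendreApprox.supNormOn f (LegendreApprox.polyellipse ξ)
  set M := min r (ξ (Fin.last d) * N)
  have hlast : 0 < ξ (Fin.last d) := zero_lt_one.trans (hξ _)
  have hN0 : 0 ≤ N := Real.iSup_nonneg fun _ => norm_nonneg _
  have hM0 : 0 ≤ M := le_min hr.le (mul_nonneg hlast.le hN0)
  have hM : ∀ z ∈ LegendreApprox.polyellipse ξ, ‖f z‖ ≤ M := fun z hz =>
    le_min (mem_ball_zero_iff.1 (hfr z hz)).le
      ((LegendreApprox.norm_le_supNormOn hfr hz).trans (le_mul_of_one_le_left hN0 (hξ _).le))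
  have hM' : ∀ z ∈ LegendreApprox.polyellipseRealLast ξ, ‖f z‖ ≤ M / ξ (Fin.last d) := by
    intro z hz
    rw [le_div_iff₀ hlast]
    refine le_min ((le_div_iff₀ hlast).1 (mem_ball_zero_iff.1 (hfr' z hz)).le) ?_
    rw [mul_comm]
    exact mul_le_mul_of_nonneg_left (LegendreApprox.norm_le_supNormOn hfr
      (LegendreApprox.polyellipseRealLast_subset hξ hz)) hlast.le
  have hc := LegendreApprox.norm_chebyshevCoeff_le hξ hf.2 hM hM'
  have hs := LegendreApprox.summable_chebyshevCoeff hξ hc hM0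
  have hfin := LegendreApprox.finite_indexSet hξ hε
  have hb : ∀ (α : Fin (d + 1) → ℕ) (p : ℕ), (∀ j, α j ≤ p) → ∀ n,
      ∀ y ∈ LegendreApprox.openCube (d + 1),
        ‖LegendreApprox.chebyshevCoeff f n * LegendreApprox.remainderJet hfin.toFinset n α y‖
          ≤ 2 * M * ε ^ τ * ∏ j, (2 * (((n j).natAbs : ℝ) + 1) ^ (2 * p + 4) *
            q ^ (n j).natAbs) := fun α p hα n y hy =>
    LegendreApprox.norm_chebyshevCoeff_mul_remainderJet_le hξ h0 hξmin hτ hε hM0 (hc n) hα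
      (LegendreApprox.mem_Icc_of_mem_openCube hy)
  have hw : ∀ p : ℕ, Summable fun n : Fin (d + 1) → ℤ => 2 * M * ε ^ τ *
      ∏ j, (2 * (((n j).natAbs : ℝ) + 1) ^ (2 * p + 4) * q ^ (n j).natAbs) := fun p =>
    (LegendreApprox.summable_weight (d + 1) p hq.1 hq.2).mul_left _
  have hjet := LegendreApprox.isJet_tsum (ι := Fin (d + 1) → ℤ)
    (fun n => (LegendreApprox.isJet_remainderJet hfin.toFinset n
      (LegendreApprox.openCube (d + 1))).const_mul (LegendreApprox.chebyshevCoeff f n))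
    -- A jet needs bounds for every α, so |α| serves as the common bound for the α_j; only |α| ≤ m
    -- enters the constant.
    (fun α => ⟨_, hw (∑ j, α j), hb α _ fun j =>
      Finset.single_le_sum (fun _ _ => Nat.zero_le _) (Finset.mem_univ j)⟩)
  have hopen := LegendreApprox.isOpen_openCube (d + 1)
  have heq : Set.EqOn (LegendreApprox.truncationError f (LegendreApprox.indexSet ξ ε))
      (fun y => ∑' n, LegendreApprox.chebyshevCoeff f n *
        LegendreApprox.remainderJet hfin.toFinset n 0 y) (LegendreApprox.openCube (d + 1)) :=
    fun y hy => LegendreApprox.truncationError_eq_tsum hξ hf.2 hs hfin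
      (LegendreApprox.mem_Icc_of_mem_openCube hy)
  refine ⟨hfin, (hjet.contDiffOn hopen m 0).congr heq, ?_, ?_⟩
  · refine iSup₂_le fun α hα => ?_
    rw [MeasureTheory.eLpNorm_exponent_top]
    refine MeasureTheory.eLpNormEssSup_le_of_ae_bound ?_
    filter_upwards [MeasureTheory.ae_restrict_mem hopen.measurableSet] with y hy
    rw [hjet.multiDeriv_eq hopen heq α hy]
    have hα' : ∀ j, α j ≤ m := fun j =>
      (Finset.single_le_sum (fun _ _ => Nat.zero_le _) (Finset.mem_univ j)).trans hα
    refine (tsum_of_norm_bounded (hw m).hasSum fun n => hb α m hα' n y hy).trans ?_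
    rw [tsum_mul_left]
    have : 0 ≤ M * ε ^ τ := mul_nonneg hM0 (Real.rpow_nonneg hε.le _)
    change 2 * M * ε ^ τ * S ≤ _
    nlinarith
  · have h := LegendreApprox.rpow_le_exp_mul_prod hξ hε
      (hε1.le.trans (inv_le_one_of_one_le₀ (hξ _).le)) hτ
    have hC : 0 ≤ (2 * S + 1) * M := by positivity
    calc _ = (2 * S + 1) * M * ε ^ τ := by ring
      _ ≤ _ := mul_le_mul_of_nonneg_left h hC
      _ = _ := by ring
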